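/- For $n\ge 1$ let $V$ be a set of $2n$ vertices split into two blocks $V_1,V_2$ of size $n$, and let $G$ be the random graph on $V$ in which the edges are present independently, an edge between two vertices of the same block with probability $a/n$ and an edge between vertices of different blocks with probability $b/n$ (for $n\ge a$). Let $A_0$ be its adjacency matrix and $d:=a+b$. The algorithm **Spectral Partition**, on input $(A_0,d)$, does the following. 1. Zero out all rows and columns of $A_0$ corresponding to vertices of degree bigger than $20d$, to obtain the matrix $A$. 2. Let $W$ be the two-dimensional space spanned by orthonormal eigenvectors of $A$ for its two largest eigenvalues (counted with multiplicity). 3. Let $v_1$ be the orthogonal projection of the all-ones vector onto $W$, and let $v_2$ be a unit vector in $W$ perpendicular to $v_1$. 4. Sort the vertices decreasingly by their values in $v_2$; let $V_1'$ consist of the first $n$ vertices and $V_2'$ of the remaining $n$ vertices. Output $(V_1',V_2')$. Choices left open here ($W$ or $v_2$ if not unique, including the sign of $v_2$, and ties in the sorting) may be made arbitrarily. A partition $\{V_1',V_2'\}$ of $V$ is called $\gamma$-correct if, possibly after exchanging the names $V_1'$ and $V_2'$, $|V_i\cap V_i'|\ge(1-\gamma)n$ for $i=1,2$. **Theorem.**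 There are absolute constants $C_0,C_1>0$ such that the following holds. For any constants $a>b>C_0$ and $\gamma>0$ satisfying $$\frac{(a-b)^2}{a+b}\ \ge\ C_1\,\frac1{\gamma^2},$$ the probability that Spectral Partition outputs a $\gamma$-correct partition, whatever the open choices, tends to $1$ as $n\to\infty$. -/

import Mathlib

noncomputable section

namespace SpectralSBM

/-! ### The two-block stochastic block model -/

/-- The real number `x`, clamped to `[0, 1]`, as a probability. For `x = a / n` the clamping has
no effect as soon as `n ≥ a`. -/
def prob (x : ℝ) : unitInterval := Set.projIcc 0 1 zero_le_one x

open Classical in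
/-- The probability of the potential edge `e`: `a / n` if both endpoints are in the block `V₁` or
both are in its complement, and `b / n` otherwise. -/
def edgeProb (n : ℕ) (a b : ℝ) (V₁ : Finset (Fin (2 * n))) (e : Sym2 (Fin (2 * n))) : unitInterval :=
  if (∀ v ∈ e, v ∈ V₁) ∨ (∀ v ∈ e, v ∉ V₁) then prob (a / n) else prob (b / n)

/-- The graph whose edges are the pairs `e` with `ω e`; the loops are discarded by
`SimpleGraph.fromEdgeSet`. -/
def graphOf {n : ℕ} (ω : Sym2 (Fin (2 * n)) → Prop) : SimpleGraph (Fin (2 * n)) :=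
  SimpleGraph.fromEdgeSet {e | ω e}

/-- The law of the random graph of the stochastic block model on `2 * n` vertices with the blocks
`V₁` and `V₁ᶜ`: the edges are present independently, each with its probability `edgeProb`. -/
def blockModel (n : ℕ) (a b : ℝ) (V₁ : Finset (Fin (2 * n))) :
    MeasureTheory.Measure (SimpleGraph (Fin (2 * n))) :=
  (MeasureTheory.Measure.pi fun e : Sym2 (Fin (2 * n)) =>
    ProbabilityTheory.bernoulliMeasure True False (edgeProb n a b V₁ e)).map graphOf

theorem measurable_graphOf (n : ℕ) : Measurable (graphOf (n := n)) := by
  refine SimpleGraph.measurable_fromEdgeSet.comp ?_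
  exact MeasurableEquiv.setOfPred.measurable

instance (n : ℕ) (a b : ℝ) (V₁ : Finset (Fin (2 * n))) :
    MeasureTheory.IsProbabilityMeasure (blockModel n a b V₁) :=
  MeasureTheory.Measure.isProbabilityMeasure_map (measurable_graphOf n).aemeasurable

open Classical in
/-- The real adjacency matrix of a graph. -/
def adjacency {n : ℕ} (G : SimpleGraph (Fin (2 * n))) :
    Matrix (Fin (2 * n)) (Fin (2 * n)) ℝ :=
  G.adjMatrix ℝ

/-! ### The algorithm -/

open Classical in
/-- The matrix obtained from the adjacency matrix `A₀` by zeroing out all rows and columns of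
vertices whose degree (row sum of `A₀`) is bigger than `20 * d`. -/
def zeroOut {N : ℕ} (A₀ : Matrix (Fin N) (Fin N) ℝ) (d : ℝ) : Matrix (Fin N) (Fin N) ℝ :=
  Matrix.of fun i j =>
    if 20 * d < ∑ k, A₀ i k ∨ 20 * d < ∑ k, A₀ j k then 0 else A₀ i j

/-- `W` is spanned by orthonormal eigenvectors of `A` belonging to its two largest eigenvalues
(counted with multiplicity). If the second and the third eigenvalue coincide, several `W`
qualify. -/
def IsTopTwoEigenspace {N : ℕ} (A : Matrix (Fin N) (Fin N) ℝ)
    (W : Submodule ℝ (EuclideanSpace ℝ (Fin N))) : Prop :=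
  ∃ (lam : Fin N → ℝ) (u : OrthonormalBasis (Fin N) ℝ (EuclideanSpace ℝ (Fin N))),
    Antitone lam ∧ (∀ k, Matrix.toEuclideanLin A (u k) = lam k • u k) ∧
      W = Submodule.span ℝ (u '' {k | (k : ℕ) < 2})

/-- `(S, T)` is a possible output of the algorithm on the input `A₀`, `d`. The choices that the
algorithm leaves open (of the eigenspace and of the vector `v₂` where they are not unique, in
particular of the sign of `v₂`, and of the order among vertices with equal values) are all
allowed. -/
def IsSpectralPartitionOutput (n : ℕ) (A₀ : Matrix (Fin (2 * n)) (Fin (2 * n)) ℝ) (d : ℝ)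
    (S T : Finset (Fin (2 * n))) : Prop :=
  ∃ (W : Submodule ℝ (EuclideanSpace ℝ (Fin (2 * n))))
    (v₁ v₂ : EuclideanSpace ℝ (Fin (2 * n))) (τ : Equiv.Perm (Fin (2 * n))),
    IsTopTwoEigenspace (zeroOut A₀ d) W ∧
    v₁ = W.starProjection (WithLp.toLp 2 fun _ => 1) ∧
    (v₂ ∈ W ∧ ‖v₂‖ = 1 ∧ inner ℝ v₁ v₂ = 0) ∧
    -- `τ k` is the vertex at position `k` when the values of `v₂` are sorted decreasingly
    (∀ k l, k ≤ l → v₂ (τ l) ≤ v₂ (τ k)) ∧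
    S = (Finset.univ.filter fun k : Fin (2 * n) => (k : ℕ) < n).image τ ∧
    T = Sᶜ

/-- The collection `{S, T}` is `γ`-correct for the blocks `V₁`, `V₂` of size `n`, where the names
of the two blocks do not matter. -/
def IsCorrect (n : ℕ) (γ : ℝ) (V₁ V₂ S T : Finset (Fin (2 * n))) : Prop :=
  ((1 - γ) * n ≤ (V₁ ∩ S).card ∧ (1 - γ) * n ≤ (V₂ ∩ T).card) ∨
  ((1 - γ) * n ≤ (V₁ ∩ T).card ∧ (1 - γ) * n ≤ (V₂ ∩ S).card)

/-- The algorithm has an output on the graph `G`, and whatever it outputs is `γ`-correct for the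
blocks `V₁`, `V₁ᶜ`. -/
def SpectralPartitionSucceeds (n : ℕ) (d γ : ℝ) (V₁ : Finset (Fin (2 * n)))
    (G : SimpleGraph (Fin (2 * n))) : Prop :=
  (∃ S T, IsSpectralPartitionOutput n (adjacency G) d S T) ∧
  ∀ S T, IsSpectralPartitionOutput n (adjacency G) d S T → IsCorrect n γ V₁ V₁ᶜ S T

end SpectralSBM

end

/-!
Write `d = a + b`. For a typical graph, trimming the vertices of large degree leaves a centered
adjacency matrix of spectral norm `O(√d)`, by the argument of Friedman, Kahn and Szemerédi and of
Feige and Ofek. On a net of the ball its quadratic form splits into the pairs with a small product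
of coordinates, which Bernstein's inequality and a union bound control, and those with a large
product, whose edges are few because no vertex set spans many more edges than expected. The norm
bound also shows that only a fraction `O(1 / √d)` of the vertices is trimmed.

The expected adjacency matrix has, up to its diagonal, the eigenvectors `1` and `χ = ±1` (the sign
of the block) with the eigenvalues `a + b` and `a - b`. By Ky Fan's maximum principle the space
`W` captures at least as much of the quadratic form of the trimmed matrix as the span of `1` and
`χ`. As the unit vector `v₂ ∈ W` is orthogonal to `1`, its squared correlation with `χ` is
therefore `1 - O(√d / (a - b))`, no perturbation bound for eigenspaces being needed. A misplaced
vertex forces `v₂` away from `χ`, so that only a fraction `O(√d / (a - b))` of the vertices is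
misplaced.
-/

noncomputable section

namespace SpectralSBM

open MeasureTheory ProbabilityTheory Finset

/-! ### Chernoff and Bernstein bounds -/

section Bernoulli

variable {ι : Type*} [Fintype ι]

open Classical in
/-- The indicator of the proposition `q`, as a real number. -/
def truth (q : Prop) : ℝ := if q then 1 else 0

lemma truth_nonneg (q : Prop) : 0 ≤ truth q := by
  unfold truth; split_ifs <;> norm_num

/-- The law of independent propositions, of which the `i`-th holds with probability `p i`. -/
abbrev indepLaw (p : ι → unitInterval) : Measure (ι → Prop) :=
  Measure.pi fun i => bernoulliMeasure True False (p i)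

lemma mgf_sum_mul_truth (p : ι → unitInterval) (c : ι → ℝ) :
    mgf (fun ω => ∑ i, c i * truth (ω i)) (indepLaw p) 1 =
      ∏ i, (1 + p i * (Real.exp (c i) - 1)) := by
  simp only [mgf, one_mul, Real.exp_sum]
  rw [integral_fintype_prod_eq_prod (f := fun i (q : Prop) => Real.exp (c i * truth q))]
  refine prod_congr rfl fun i _ => ?_
  rw [integral_bernoulliMeasure]
  simp only [truth, if_true, if_false, mul_one, mul_zero, Real.exp_zero, smul_eq_mul]
  ring

theorem indepLaw_chernoff (p : ι → unitInterval) (c : ι → ℝ) (t : ℝ) :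
    (indepLaw p).real {ω | t ≤ ∑ i, c i * truth (ω i)} ≤
      Real.exp (-t + ∑ i, p i * (Real.exp (c i) - 1)) := by
  refine (measure_ge_le_exp_mul_mgf t zero_le_one .of_finite).trans ?_
  rw [mgf_sum_mul_truth, Real.exp_add, neg_one_mul, Real.exp_sum]
  gcongr with i
  · intro i _
    have h0 := (p i).2.1
    have h1 := (p i).2.2
    nlinarith [Real.exp_pos (c i)]
  · linarith [Real.add_one_le_exp (p i * (Real.exp (c i) - 1))]

theorem indepLaw_bernstein (p : ι → unitInterval) (c : ι → ℝ) (t : ℝ) (hc : ∀ i, |c i| ≤ 1) :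
    (indepLaw p).real {ω | t ≤ ∑ i, c i * (truth (ω i) - p i)} ≤
      Real.exp (-t + ∑ i, p i * c i ^ 2) := by
  have hset : {ω : ι → Prop | t ≤ ∑ i, c i * (truth (ω i) - p i)} =
      {ω | t + ∑ i, c i * p i ≤ ∑ i, c i * truth (ω i)} := by
    simp only [mul_sub, sum_sub_distrib, le_sub_iff_add_le]
  rw [hset]
  refine (indepLaw_chernoff p c _).trans (Real.exp_le_exp.2 ?_)
  have hterm : ∑ i, p i * (Real.exp (c i) - 1) ≤ ∑ i, (p i * c i ^ 2 + c i * p i) := by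
    refine sum_le_sum fun i _ => ?_
    have hexp := (abs_le.1 (Real.abs_exp_sub_one_sub_id_le (hc i))).2
    nlinarith [(p i).2.1]
  rw [sum_add_distrib] at hterm
  linarith

end Bernoulli

section Pairs

variable {V : Type*} [DecidableEq V]

/-- The adjacency matrix of the graph whose edges are the pairs `e` with `ω e`, without loops. -/
def edgeMatrix (ω : Sym2 V → Prop) : Matrix V V ℝ :=
  Matrix.of fun u v => if u = v then 0 else truth (ω s(u, v))

/-- The expectation of `edgeMatrix` under `indepLaw p`. -/
def meanMatrix (p : Sym2 V → unitInterval) : Matrix V V ℝ :=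
  Matrix.of fun u v => if u = v then 0 else (p s(u, v) : ℝ)

/-- The centered adjacency matrix. -/
def noise (p : Sym2 V → unitInterval) (ω : Sym2 V → Prop) : Matrix V V ℝ :=
  edgeMatrix ω - meanMatrix p

lemma edgeMatrix_nonneg (ω : Sym2 V → Prop) (u v : V) : 0 ≤ edgeMatrix ω u v := by
  simp only [edgeMatrix, Matrix.of_apply]
  split_ifs
  exacts [le_rfl, truth_nonneg _]

lemma meanMatrix_nonneg (p : Sym2 V → unitInterval) (u v : V) : 0 ≤ meanMatrix p u v := by
  simp only [meanMatrix, Matrix.of_apply]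
  split_ifs
  exacts [le_rfl, (p _).2.1]

lemma edgeMatrix_comm (ω : Sym2 V → Prop) (u v : V) : edgeMatrix ω u v = edgeMatrix ω v u := by
  simp only [edgeMatrix, Matrix.of_apply, eq_comm, Sym2.eq_swap]

lemma noise_comm (p : Sym2 V → unitInterval) (ω : Sym2 V → Prop) (u v : V) :
    noise p ω u v = noise p ω v u := by
  simp only [noise, edgeMatrix, meanMatrix, Matrix.sub_apply, Matrix.of_apply, eq_comm,
    Sym2.eq_swap]

variable [Fintype V]

/-- The ordered pairs with different entries that form the unordered pair `e`. -/
def orderings (e : Sym2 V) : Finset (V × V) := {z | z.1 ≠ z.2 ∧ s(z.1, z.2) = e}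

/-- The weight that an unordered pair receives from a weight on ordered pairs. -/
def pairWeight (w : V → V → ℝ) (e : Sym2 V) : ℝ := ∑ z ∈ orderings e, w z.1 z.2

lemma card_orderings_le (e : Sym2 V) : #(orderings e) ≤ 2 := by
  induction e using Sym2.ind with
  | _ x y =>
    refine (card_le_card (t := {(x, y), (y, x)}) ?_).trans card_le_two
    rintro ⟨u, v⟩ h
    simp only [orderings, mem_filter, mem_univ, true_and, Sym2.eq_iff] at h
    simp only [mem_insert, mem_singleton, Prod.mk.injEq]
    exact h.2

lemma sum_pairWeight_mul (w : V → V → ℝ) (f : Sym2 V → ℝ) :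
    ∑ e, pairWeight w e * f e = ∑ u, ∑ v, w u v * if u = v then 0 else f s(u, v) := by
  rw [← Fintype.sum_prod_type' (f := fun u v => w u v * if u = v then 0 else f s(u, v))]
  simp only [pairWeight, orderings, sum_mul, sum_filter]
  rw [sum_comm]
  refine sum_congr rfl fun z _ => ?_
  by_cases h : z.1 = z.2 <;> simp [h]

lemma sum_pairWeight_mul_truth (w : V → V → ℝ) (ω : Sym2 V → Prop) :
    ∑ e, pairWeight w e * truth (ω e) = ∑ u, ∑ v, w u v * edgeMatrix ω u v :=
  sum_pairWeight_mul w fun e => truth (ω e)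

lemma sum_pairWeight_mul_truth_sub (w : V → V → ℝ) (p : Sym2 V → unitInterval)
    (ω : Sym2 V → Prop) :
    ∑ e, pairWeight w e * (truth (ω e) - p e) = ∑ u, ∑ v, w u v * noise p ω u v := by
  rw [sum_pairWeight_mul w fun e => truth (ω e) - (p e : ℝ)]
  refine sum_congr rfl fun u _ => sum_congr rfl fun v _ => ?_
  by_cases h : u = v <;> simp [noise, edgeMatrix, meanMatrix, h]

lemma sum_pairWeight_le {w : V → V → ℝ} (hw : ∀ u v, 0 ≤ w u v) :
    ∑ e, pairWeight w e ≤ ∑ u, ∑ v, w u v := by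
  have h := sum_pairWeight_mul w fun _ => 1
  simp only [mul_one] at h
  rw [h]
  refine sum_le_sum fun u _ => sum_le_sum fun v _ => ?_
  split_ifs
  · simpa using hw u v
  · simp

lemma abs_pairWeight_le {w : V → V → ℝ} {c : ℝ} (hc : 0 ≤ c) (hw : ∀ u v, |w u v| ≤ c)
    (e : Sym2 V) : |pairWeight w e| ≤ 2 * c := by
  refine (abs_sum_le_sum_abs _ _).trans ((sum_le_card_nsmul _ _ c fun z _ => hw _ _).trans ?_)
  rw [nsmul_eq_mul]
  gcongr
  exact_mod_cast card_orderings_le e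

lemma sum_sq_pairWeight_le (w : V → V → ℝ) :
    ∑ e, pairWeight w e ^ 2 ≤ 2 * ∑ u, ∑ v, w u v ^ 2 :=
  calc ∑ e, pairWeight w e ^ 2 ≤ ∑ e, 2 * pairWeight (fun u v => w u v ^ 2) e := by
        refine sum_le_sum fun e _ => ?_
        refine (sq_sum_le_card_mul_sum_sq (s := orderings e) (f := fun z => w z.1 z.2)).trans ?_
        exact mul_le_mul_of_nonneg_right (mod_cast card_orderings_le e)
          (sum_nonneg fun _ _ => sq_nonneg _)
    _ ≤ 2 * ∑ u, ∑ v, w u v ^ 2 := by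
        rw [← mul_sum]
        gcongr
        exact sum_pairWeight_le fun _ _ => sq_nonneg _

variable {p : Sym2 V → unitInterval} {q : ℝ}

theorem measure_le_sum_mul_noise_le (hq : 0 ≤ q) (hp : ∀ e, p e ≤ q) {w : V → V → ℝ}
    (hw : ∀ u v, |w u v| ≤ 1 / 2) (t : ℝ) :
    (indepLaw p).real {ω | t ≤ ∑ u, ∑ v, w u v * noise p ω u v} ≤
      Real.exp (-t + 2 * q * ∑ u, ∑ v, w u v ^ 2) := by
  simp only [← sum_pairWeight_mul_truth_sub]
  refine (indepLaw_bernstein p _ t fun e => ?_).trans (Real.exp_le_exp.2 ?_)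
  · simpa using abs_pairWeight_le (by norm_num) hw e
  have hvar : ∑ e, p e * pairWeight w e ^ 2 ≤ q * ∑ e, pairWeight w e ^ 2 := by
    rw [mul_sum]
    gcongr
    exact hp _
  nlinarith [sum_sq_pairWeight_le w]

lemma exp_mul_sub_one_le {x θ : ℝ} (hx0 : 0 ≤ x) (hx1 : x ≤ 1) :
    Real.exp (x * θ) - 1 ≤ x * Real.exp θ := by
  have hconv := convexOn_exp.2 (Set.mem_univ θ) (Set.mem_univ 0) hx0 (sub_nonneg.2 hx1)
    (add_sub_cancel x 1)
  simp only [smul_eq_mul, mul_zero, add_zero, Real.exp_zero, mul_one] at hconv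
  linarith

theorem measure_le_sum_mul_edgeMatrix_le (hq : 0 ≤ q) (hp : ∀ e, p e ≤ q) {w : V → V → ℝ}
    (hw0 : ∀ u v, 0 ≤ w u v) (hw1 : ∀ u v, w u v ≤ 1) {θ : ℝ} (hθ : 0 ≤ θ) (k : ℝ) :
    (indepLaw p).real {ω | 2 * k ≤ ∑ u, ∑ v, w u v * edgeMatrix ω u v} ≤
      Real.exp (-(θ * k) + q * (∑ u, ∑ v, w u v) * Real.exp θ) := by
  have hweight : ∀ e, 0 ≤ pairWeight w e / 2 ∧ pairWeight w e / 2 ≤ 1 := fun e => by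
    have hle := abs_pairWeight_le zero_le_one
      (fun u v => (abs_of_nonneg (hw0 u v)).trans_le (hw1 u v)) e
    have h0 : 0 ≤ pairWeight w e := sum_nonneg fun _ _ => hw0 _ _
    constructor <;> linarith [le_of_abs_le hle]
  have hsub : {ω | 2 * k ≤ ∑ u, ∑ v, w u v * edgeMatrix ω u v} ⊆
      {ω | θ * k ≤ ∑ e, pairWeight w e / 2 * θ * truth (ω e)} := fun ω hω => by
    have hsum : ∑ e, pairWeight w e / 2 * θ * truth (ω e) =
        θ * ((∑ e, pairWeight w e * truth (ω e)) / 2) := by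
      rw [sum_div, mul_sum]
      exact sum_congr rfl fun e _ => by ring
    simp only [Set.mem_ofPred_eq, ← sum_pairWeight_mul_truth] at hω
    simp only [Set.mem_ofPred_eq, hsum]
    gcongr
    linarith
  refine (measureReal_mono hsub).trans ((indepLaw_chernoff p _ _).trans (Real.exp_le_exp.2 ?_))
  gcongr
  calc ∑ e, p e * (Real.exp (pairWeight w e / 2 * θ) - 1)
      ≤ ∑ e, q * (pairWeight w e * Real.exp θ) := by
        refine sum_le_sum fun e _ => ?_
        obtain ⟨h0, h1⟩ := hweight e
        have hexp := exp_mul_sub_one_le (θ := θ) h0 h1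
        exact mul_le_mul (hp e) (by nlinarith [Real.exp_pos θ])
          (sub_nonneg.2 (Real.one_le_exp (mul_nonneg h0 hθ))) hq
    _ = q * (∑ e, pairWeight w e) * Real.exp θ := by rw [← mul_sum, ← sum_mul, mul_assoc]
    _ ≤ q * (∑ u, ∑ v, w u v) * Real.exp θ := by
        gcongr
        exact sum_pairWeight_le hw0

end Pairs

/-! ### Regular graphs -/

lemma measureReal_not_forall_mem_le {α Ω : Type*} [MeasurableSpace Ω] (μ : Measure Ω)
    (s : Finset α) {P : α → Ω → Prop} {ε : α → ℝ}
    (h : ∀ i ∈ s, μ.real {ω | ¬ P i ω} ≤ ε i) :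
    μ.real {ω | ¬ ∀ i ∈ s, P i ω} ≤ ∑ i ∈ s, ε i := by
  have hset : {ω | ¬ ∀ i ∈ s, P i ω} = ⋃ i ∈ s, {ω | ¬ P i ω} := by
    ext ω; simp
  rw [hset]
  exact (measureReal_biUnion_finset_le _ _).trans (sum_le_sum h)

section Counting

lemma sum_Icc_half_pow_natAbs (R : ℕ) :
    ∑ k ∈ Icc (-(R : ℤ)) R, (1 / 2 : ℝ) ^ k.natAbs = 3 - 2 * (1 / 2) ^ R := by
  induction R with
  | zero => norm_num
  | succ R ih =>
    have hIcc : Icc (-((R + 1 : ℕ) : ℤ)) ((R + 1 : ℕ) : ℤ) =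
        insert ((R + 1 : ℕ) : ℤ) (insert (-((R + 1 : ℕ) : ℤ)) (Icc (-(R : ℤ)) R)) := by
      ext k; simp only [mem_Icc, mem_insert]; push_cast; omega
    rw [hIcc, sum_insert, sum_insert, ih, Int.natAbs_neg, Int.natAbs_natCast]
    · ring
    · simp
    · simp only [mem_insert, mem_Icc]; push_cast; omega

lemma exp_neg_sq_le_half_pow_natAbs (k : ℤ) :
    Real.exp (-(k : ℝ) ^ 2) ≤ (1 / 2 : ℝ) ^ k.natAbs := by
  have hle : (k.natAbs : ℝ) ≤ (k : ℝ) ^ 2 := by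
    have : k.natAbs ≤ k.natAbs ^ 2 := Nat.le_self_pow two_ne_zero _
    calc (k.natAbs : ℝ) ≤ (k.natAbs : ℝ) ^ 2 := by exact_mod_cast this
      _ = (k : ℝ) ^ 2 := by rw [Nat.cast_natAbs, Int.cast_abs, sq_abs]
  calc Real.exp (-(k : ℝ) ^ 2) ≤ Real.exp (k.natAbs * -1) := by gcongr; linarith
    _ = (Real.exp (-1)) ^ k.natAbs := Real.exp_nat_mul _ _
    _ ≤ (1 / 2) ^ k.natAbs := by
      gcongr
      rw [Real.exp_neg, one_div]
      gcongr
      linarith [Real.add_one_le_exp 1]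

lemma sum_exp_neg_sq_le (R : ℕ) :
    ∑ k ∈ Icc (-(R : ℤ)) R, Real.exp (-(k : ℝ) ^ 2) ≤ Real.exp 2 := by
  have hsum := sum_le_sum fun k (_ : k ∈ Icc (-(R : ℤ)) R) => exp_neg_sq_le_half_pow_natAbs k
  rw [sum_Icc_half_pow_natAbs] at hsum
  have hpow : (0 : ℝ) ≤ (1 / 2) ^ R := by positivity
  linarith [Real.add_one_le_exp 2]

variable {V : Type*} [Fintype V]

open Classical in
/-- The integer vectors of squared Euclidean norm at most `r`. -/
def latticeBall (V : Type*) [Fintype V] (r : ℕ) : Finset (V → ℤ) :=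
  {z ∈ Fintype.piFinset fun _ => Icc (-(r : ℤ)) r | ∑ u, z u ^ 2 ≤ (r : ℤ)}

lemma mem_latticeBall {r : ℕ} {z : V → ℤ} : z ∈ latticeBall V r ↔ ∑ u, z u ^ 2 ≤ (r : ℤ) := by
  simp only [latticeBall, mem_filter, Fintype.mem_piFinset, mem_Icc, and_iff_right_iff_imp]
  intro h u
  have hsq : z u ^ 2 ≤ r :=
    (single_le_sum (f := fun u => z u ^ 2) (fun _ _ => sq_nonneg _) (mem_univ u)).trans h
  have hpos := Int.le_self_sq (z u)
  have hneg := Int.le_self_sq (-z u)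
  rw [neg_sq] at hneg
  omega

lemma card_latticeBall_le (V : Type*) [Fintype V] (r : ℕ) :
    (#(latticeBall V r) : ℝ) ≤ Real.exp (r + 2 * Fintype.card V) := by
  classical
  calc (#(latticeBall V r) : ℝ) = ∑ z ∈ latticeBall V r, 1 := by simp
    _ ≤ ∑ z ∈ latticeBall V r, Real.exp r * ∏ u, Real.exp (-(z u : ℝ) ^ 2) := by
      refine sum_le_sum fun z hz => ?_
      have hz' : ∑ u, (z u : ℝ) ^ 2 ≤ r := mod_cast mem_latticeBall.1 hz
      rw [← Real.exp_sum, ← Real.exp_add, sum_neg_distrib]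
      exact Real.one_le_exp (by linarith)
    _ ≤ ∑ z ∈ Fintype.piFinset fun _ : V => Icc (-(r : ℤ)) r,
        Real.exp r * ∏ u, Real.exp (-(z u : ℝ) ^ 2) :=
      sum_le_sum_of_subset_of_nonneg (filter_subset _ _) fun _ _ _ => by positivity
    _ = Real.exp r * ∏ _u : V, ∑ k ∈ Icc (-(r : ℤ)) r, Real.exp (-(k : ℝ) ^ 2) := by
      rw [← mul_sum, prod_univ_sum]
    _ ≤ Real.exp r * ∏ _u : V, Real.exp 2 := by
      gcongr
      exact sum_exp_neg_sq_le r
    _ = Real.exp (r + 2 * Fintype.card V) := by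
      rw [prod_const, card_univ, ← Real.exp_nat_mul, ← Real.exp_add, mul_comm 2]

/-- An upper bound for the logarithm of the binomial coefficient `n.choose t`. -/
def entropyBound (n t : ℝ) : ℝ := t * (1 + Real.log (n / t))

lemma choose_le_exp_entropyBound {n t : ℕ} (hn : 0 < n) (ht : 0 < t) :
    (n.choose t : ℝ) ≤ Real.exp (entropyBound n t) :=
  calc (n.choose t : ℝ) ≤ (n : ℝ) ^ t / t.factorial := Nat.choose_le_pow_div t n
    _ = (n / t : ℝ) ^ t * ((t : ℝ) ^ t / t.factorial) := by rw [div_pow]; field_simp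
    _ ≤ (n / t : ℝ) ^ t * Real.exp t := by
      gcongr
      exact Real.pow_div_factorial_le_exp t t.cast_nonneg t
    _ = Real.exp (entropyBound n t) := by
      rw [entropyBound, mul_add, mul_one, Real.exp_add, Real.exp_nat_mul,
        Real.exp_log (by positivity), mul_comm]

lemma le_entropyBound {n t : ℝ} (ht : 0 < t) (htn : t ≤ n) : t ≤ entropyBound n t :=
  le_mul_of_one_le_right ht.le
    (le_add_of_nonneg_right (Real.log_nonneg ((one_le_div ht).2 htn)))

lemma log_le_entropyBound {n t : ℝ} (ht : 1 ≤ t) (htn : t ≤ n) :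
    Real.log n ≤ entropyBound n t := by
  have hlog : 0 ≤ Real.log (n / t) := Real.log_nonneg ((one_le_div (by linarith)).2 htn)
  rw [entropyBound]
  rw [Real.log_div (by linarith) (by linarith)] at hlog ⊢
  nlinarith [Real.log_le_sub_one_of_pos (x := t) (by linarith)]

lemma choose_mul_two_pow_mul_exp_le {n t : ℕ} (ht : 0 < t) (htn : t ≤ n) :
    (n.choose t : ℝ) * (2 ^ t * Real.exp (-(4 * entropyBound n t))) ≤ ((n : ℝ) ^ 2)⁻¹ := by
  have ht1 : (1 : ℝ) ≤ t := by exact_mod_cast ht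
  have htn' : (t : ℝ) ≤ n := by exact_mod_cast htn
  set y := entropyBound n t
  have hpow : (2 : ℝ) ^ t ≤ Real.exp y :=
    calc (2 : ℝ) ^ t ≤ Real.exp 1 ^ t := by gcongr; linarith [Real.add_one_le_exp 1]
      _ = Real.exp t := by rw [← Real.exp_nat_mul, mul_one]
      _ ≤ Real.exp y := Real.exp_le_exp.2 (le_entropyBound (by linarith) htn')
  calc (n.choose t : ℝ) * (2 ^ t * Real.exp (-(4 * y)))
      ≤ Real.exp y * (Real.exp y * Real.exp (-(4 * y))) := by
        gcongr
        exact choose_le_exp_entropyBound (ht.trans_le htn) ht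
    _ = Real.exp (-((2 : ℕ) * y)) := by rw [← Real.exp_add, ← Real.exp_add]; push_cast; ring_nf
    _ ≤ Real.exp (-((2 : ℕ) * Real.log n)) := by
        gcongr
        exact log_le_entropyBound ht1 htn'
    _ = ((n : ℝ) ^ 2)⁻¹ := by
        rw [Real.exp_neg, Real.exp_nat_mul, Real.exp_log (by linarith)]

/-- The union bound over all pairs `S ⊆ T` of nonempty vertex sets, sorted by the size of `T`. -/
lemma sum_two_pow_card_mul_exp_le [Nonempty V] :
    ∑ T : Finset V, (if #T = 0 then 0 else
      2 ^ #T * Real.exp (-(4 * entropyBound (Fintype.card V) #T))) ≤ 1 / (Fintype.card V : ℝ) := by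
  set n := Fintype.card V with hn
  have hn0 : (n : ℝ) ≠ 0 := by positivity
  calc _ = ∑ t ∈ range (n + 1), (n.choose t : ℝ) *
        (if t = 0 then 0 else 2 ^ t * Real.exp (-(4 * entropyBound n t))) := by
        rw [← powerset_univ, sum_powerset_apply_card
          fun t => if t = 0 then 0 else 2 ^ t * Real.exp (-(4 * entropyBound n t))]
        simp only [nsmul_eq_mul, card_univ, hn]
    _ ≤ ∑ t ∈ range (n + 1), if t = 0 then 0 else ((n : ℝ) ^ 2)⁻¹ := by
        refine sum_le_sum fun t ht => ?_
        split_ifs with h0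
        · simp
        · exact choose_mul_two_pow_mul_exp_le (Nat.pos_of_ne_zero h0)
            (Nat.lt_succ_iff.1 (mem_range.1 ht))
    _ = 1 / n := by
        rw [sum_range_succ']
        simp only [Nat.add_eq_zero_iff, one_ne_zero, and_false, if_false, if_true, add_zero,
          sum_const, card_range, nsmul_eq_mul]
        field_simp

end Counting

section QuadForm

variable {V : Type*} [Fintype V]

/-- The quadratic form of the matrix `M`. -/
def quadForm (M : Matrix V V ℝ) (x : V → ℝ) : ℝ := ∑ u, ∑ v, x u * x v * M u v

/-- The part of the quadratic form `quadForm M x` that comes from the pairs with a product of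
coordinates at most `c`. -/
def lightPart (c : ℝ) (M : Matrix V V ℝ) (x : V → ℝ) : ℝ :=
  ∑ u, ∑ v, (if |x u * x v| ≤ c then x u * x v else 0) * M u v

/-- The part of the quadratic form `quadForm M x` that comes from the pairs with a product of
coordinates above `c`. -/
def heavyPart (c : ℝ) (M : Matrix V V ℝ) (x : V → ℝ) : ℝ :=
  ∑ u, ∑ v, (if c < |x u * x v| then x u * x v else 0) * M u v

lemma lightPart_add_heavyPart (c : ℝ) (M : Matrix V V ℝ) (x : V → ℝ) :
    lightPart c M x + heavyPart c M x = quadForm M x := by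
  simp only [lightPart, heavyPart, quadForm, ← sum_add_distrib, ← add_mul]
  refine sum_congr rfl fun u _ => sum_congr rfl fun v _ => ?_
  rcases le_or_gt |x u * x v| c with h | h
  · rw [if_pos h, if_neg h.not_gt, add_zero]
  · rw [if_neg h.not_ge, if_pos h, zero_add]

lemma lightPart_eq_quadForm {c : ℝ} {x : V → ℝ} (hx : ∀ u v, |x u * x v| ≤ c)
    (M : Matrix V V ℝ) : lightPart c M x = quadForm M x := by
  simp only [lightPart, quadForm, hx, if_true]

open Classical in
/-- A net of the Euclidean ball of radius `√|V|`: the points of the ball with coordinates in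
`ℤ / 4`. -/
def latticeNet (V : Type*) [Fintype V] : Finset (V → ℝ) :=
  (latticeBall V (16 * Fintype.card V)).image fun z u => (z u : ℝ) / 4

lemma int_div_four_mem_latticeNet {z : V → ℤ} (hz : ∑ u, z u ^ 2 ≤ 16 * (Fintype.card V : ℤ)) :
    (fun u => (z u : ℝ) / 4) ∈ latticeNet V :=
  mem_image_of_mem _ (mem_latticeBall.2 (by exact_mod_cast hz))

lemma int_mem_latticeNet {z : V → ℤ} (hz : ∀ u, |z u| ≤ 1) :
    (fun u => (z u : ℝ)) ∈ latticeNet V := by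
  have hmem := int_div_four_mem_latticeNet (z := fun u => 4 * z u) <|
    calc ∑ u, (4 * z u) ^ 2 ≤ ∑ _u : V, 16 := by
          refine sum_le_sum fun u _ => ?_
          linarith [(sq_le_one_iff_abs_le_one _).2 (hz u)]
      _ = 16 * (Fintype.card V : ℤ) := by simp [mul_comm]
  simpa [mul_div_cancel_left₀] using hmem

lemma sum_sq_le_of_mem_latticeNet {y : V → ℝ} (hy : y ∈ latticeNet V) :
    ∑ u, y u ^ 2 ≤ Fintype.card V := by
  obtain ⟨z, hz, rfl⟩ := mem_image.1 hy
  have hz' : ∑ u, (z u : ℝ) ^ 2 ≤ 16 * Fintype.card V := mod_cast mem_latticeBall.1 hz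
  simp only [div_pow, ← sum_div]
  linarith

lemma indicator_mem_latticeNet (L : Set V) {y : V → ℝ} (hy : y ∈ latticeNet V) :
    L.indicator y ∈ latticeNet V := by
  classical
  obtain ⟨z, hz, rfl⟩ := mem_image.1 hy
  refine mem_image.2 ⟨L.indicator z, mem_latticeBall.2 ?_, ?_⟩
  · refine (sum_le_sum fun u _ => ?_).trans (mem_latticeBall.1 hz)
    by_cases hu : u ∈ L <;> simp [hu, sq_nonneg]
  · ext u
    by_cases hu : u ∈ L <;> simp [hu]

lemma card_latticeNet_le (V : Type*) [Fintype V] :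
    (#(latticeNet V) : ℝ) ≤ Real.exp (18 * Fintype.card V) := by
  refine (Nat.cast_le.2 card_image_le).trans ((card_latticeBall_le V _).trans_eq ?_)
  push_cast
  ring_nf

end QuadForm

section Regularity

/-- The bound on the number of edges between a set of `s` vertices and a set of `t ≥ s` vertices,
out of `N`, in a regular graph of average degree `d`. -/
def discrepancyBound (N d s t : ℝ) : ℝ :=
  12 * d * s * t / N + 12 * entropyBound N t / Real.log (Real.exp 1 + N / (d * s))

variable {V : Type*} [Fintype V] [DecidableEq V] {p : Sym2 V → unitInterval} {d : ℝ}

/-- No set of vertices spans many more edges than expected: the bound `discrepancyBound` holds for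
the weight `E` of the pairs between any nested pair of vertex sets. -/
def HasDiscrepancy (d : ℝ) (E : Matrix V V ℝ) : Prop :=
  ∀ S T : Finset V, S ⊆ T → S.Nonempty →
    ∑ u ∈ S, ∑ v ∈ T, E u v ≤ discrepancyBound (Fintype.card V) d #S #T

/-- The properties of a typical random graph on which the analysis of the algorithm rests. -/
structure IsRegular (d : ℝ) (p : Sym2 V → unitInterval) (ω : Sym2 V → Prop) : Prop where
  light : ∀ y ∈ latticeNet V, |lightPart √d (noise p ω) y| ≤ 40 * √d * Fintype.card V
  discrepancy : HasDiscrepancy d (edgeMatrix ω)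

lemma measure_not_abs_sum_mul_noise_le [Nonempty V] (hd : 0 < d)
    (hp : ∀ e, p e ≤ 2 * d / Fintype.card V) {w : V → V → ℝ} (hw : ∀ u v, |w u v| ≤ √d)
    (hw2 : ∑ u, ∑ v, w u v ^ 2 ≤ (Fintype.card V : ℝ) ^ 2) :
    (indepLaw p).real {ω | ¬ |∑ u, ∑ v, w u v * noise p ω u v| ≤ 40 * √d * Fintype.card V} ≤
      2 * Real.exp (-(19 * Fintype.card V)) := by
  set N : ℝ := (Fintype.card V : ℝ)
  have hN : 0 < N := by positivity
  have hs : 0 < √d := Real.sqrt_pos.2 hd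
  have htail : ∀ ε : ℝ, |ε| = 1 → (indepLaw p).real
      {ω | 20 * N ≤ ∑ u, ∑ v, ε * w u v / (2 * √d) * noise p ω u v} ≤
      Real.exp (-(19 * N)) := fun ε hε => by
    refine (measure_le_sum_mul_noise_le (by positivity) hp (fun u v => ?_) _).trans
      (Real.exp_le_exp.2 ?_)
    · rw [abs_div, abs_mul, hε, one_mul, abs_of_pos (mul_pos two_pos hs),
        div_le_iff₀ (mul_pos two_pos hs)]
      linarith [hw u v]
    · have hsq : ∀ u v, (ε * w u v / (2 * √d)) ^ 2 = w u v ^ 2 / (4 * d) := fun u v => by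
        rw [div_pow, mul_pow, mul_pow, Real.sq_sqrt hd.le, ← sq_abs ε, hε]
        ring
      simp only [hsq, ← sum_div]
      have hvar : 2 * (2 * d / N) * ((∑ u, ∑ v, w u v ^ 2) / (4 * d)) ≤
          2 * (2 * d / N) * (N ^ 2 / (4 * d)) := by gcongr
      have hN' : 2 * (2 * d / N) * (N ^ 2 / (4 * d)) = N := by field_simp; norm_num
      linarith
  have hsub : {ω | ¬ |∑ u, ∑ v, w u v * noise p ω u v| ≤ 40 * √d * N} ⊆
      {ω | 20 * N ≤ ∑ u, ∑ v, 1 * w u v / (2 * √d) * noise p ω u v} ∪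
      {ω | 20 * N ≤ ∑ u, ∑ v, -1 * w u v / (2 * √d) * noise p ω u v} := fun ω hω => by
    have hsum : ∀ ε : ℝ, ∑ u, ∑ v, ε * w u v / (2 * √d) * noise p ω u v =
        ε * (∑ u, ∑ v, w u v * noise p ω u v) / (2 * √d) := fun ε => by
      simp only [mul_sum, sum_div]
      exact sum_congr rfl fun u _ => sum_congr rfl fun v _ => by ring
    simp only [Set.mem_ofPred_eq, not_le, lt_abs] at hω
    simp only [Set.mem_union, Set.mem_ofPred_eq, hsum, le_div_iff₀ (mul_pos two_pos hs)]
    exact hω.imp (fun h => by linarith) fun h => by linarith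
  refine (measureReal_mono hsub).trans ((measureReal_union_le _ _).trans ?_)
  linarith [htail 1 (by simp), htail (-1) (by simp)]

lemma measure_not_light_le [Nonempty V] (hd : 0 < d)
    (hp : ∀ e, p e ≤ 2 * d / Fintype.card V) :
    (indepLaw p).real {ω | ¬ ∀ y ∈ latticeNet V,
      |lightPart √d (noise p ω) y| ≤ 40 * √d * Fintype.card V} ≤
      2 * Real.exp (-Fintype.card V) := by
  refine (measureReal_not_forall_mem_le _ _ fun y hy =>
    measure_not_abs_sum_mul_noise_le hd hp (w := fun u v => _) (fun u v => ?_) ?_).trans ?_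
  · split_ifs with h
    exacts [h, by simp]
  · calc ∑ u, ∑ v, (if |y u * y v| ≤ √d then y u * y v else 0) ^ 2
        ≤ ∑ u, ∑ v, y u ^ 2 * y v ^ 2 := by
          refine sum_le_sum fun u _ => sum_le_sum fun v _ => ?_
          split_ifs
          · rw [mul_pow]
          · rw [zero_pow two_ne_zero]; positivity
      _ = (∑ u, y u ^ 2) ^ 2 := by rw [← sum_mul_sum, sq]
      _ ≤ (Fintype.card V : ℝ) ^ 2 := by
          gcongr
          exact sum_sq_le_of_mem_latticeNet hy
  · rw [sum_const, nsmul_eq_mul]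
    calc #(latticeNet V) * (2 * Real.exp (-(19 * Fintype.card V)))
        ≤ Real.exp (18 * Fintype.card V) * (2 * Real.exp (-(19 * Fintype.card V))) := by
          gcongr
          exact card_latticeNet_le V
      _ = 2 * Real.exp (-Fintype.card V) := by
          rw [mul_left_comm, ← Real.exp_add]
          ring_nf

lemma measure_le_sum_sum_edgeMatrix_le {q : ℝ} (hq : 0 ≤ q) (hp : ∀ e, p e ≤ q) (S T : Finset V)
    {θ : ℝ} (hθ : 0 ≤ θ) (k : ℝ) :
    (indepLaw p).real {ω | 2 * k ≤ ∑ u ∈ S, ∑ v ∈ T, edgeMatrix ω u v} ≤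
      Real.exp (-(θ * k) + q * (#S * #T) * Real.exp θ) := by
  have h := measure_le_sum_mul_edgeMatrix_le hq hp
    (w := fun u v => if u ∈ S ∧ v ∈ T then 1 else 0) (fun u v => by split_ifs <;> norm_num)
    (fun u v => by split_ifs <;> norm_num) hθ k
  simpa [ite_and, ite_mul, sum_ite_irrel, sum_ite_mem] using h

lemma measure_not_discrepancy_pair_le (hd : 0 < d) (hp : ∀ e, p e ≤ 2 * d / Fintype.card V)
    {S T : Finset V} (hST : S ⊆ T) (hS : S.Nonempty) :
    (indepLaw p).real {ω | ¬ ∑ u ∈ S, ∑ v ∈ T, edgeMatrix ω u v ≤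
      discrepancyBound (Fintype.card V) d #S #T} ≤
      Real.exp (-(4 * entropyBound (Fintype.card V) #T)) := by
  set N : ℝ := (Fintype.card V : ℝ)
  set s : ℝ := (#S : ℝ)
  set t : ℝ := (#T : ℝ)
  have hs : 0 < s := Nat.cast_pos.2 hS.card_pos
  have ht : 0 < t := Nat.cast_pos.2 (hS.mono hST).card_pos
  have htN : t ≤ N := Nat.cast_le.2 (card_le_univ T)
  have hN : 0 < N := ht.trans_le htN
  have hent := le_entropyBound ht htN
  set H := entropyBound N t
  set θ := Real.log (Real.exp 1 + N / (d * s)) with hθ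
  have hpos : 0 < N / (d * s) := by positivity
  have hexp : Real.exp θ = Real.exp 1 + N / (d * s) := Real.exp_log (by positivity)
  have hθ1 : 1 ≤ θ := by
    rw [hθ, Real.le_log_iff_exp_le (by positivity)]
    linarith
  set k := (6 * d * s * t / N + 6 * H) / θ with hk
  have hkle : 2 * k ≤ discrepancyBound N d s t := by
    have hdiv : 12 * d * s * t / N / θ ≤ 12 * d * s * t / N :=
      div_le_self (by positivity) hθ1
    calc 2 * k = 12 * d * s * t / N / θ + 12 * H / θ := by rw [hk]; ring
      _ ≤ discrepancyBound N d s t := by rw [discrepancyBound]; gcongr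
  have hchernoff := measure_le_sum_sum_edgeMatrix_le (by positivity) hp S T (by linarith : 0 ≤ θ) k
  rw [hexp] at hchernoff
  refine (measureReal_mono fun ω hω => ?_).trans (hchernoff.trans (Real.exp_le_exp.2 ?_))
  · simp only [Set.mem_ofPred_eq, not_le] at hω ⊢
    linarith
  · have hθk : θ * k = 6 * (d * s * t / N) + 6 * H := by rw [hk]; field_simp
    have hmean : 2 * d / N * (s * t) * (Real.exp 1 + N / (d * s)) =
        Real.exp 1 * (2 * (d * s * t / N)) + 2 * t := by field_simp
    have he : Real.exp 1 * (2 * (d * s * t / N)) ≤ 3 * (2 * (d * s * t / N)) := by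
      gcongr
      exact Real.exp_one_lt_three.le
    linarith

lemma measure_not_discrepancy_le [Nonempty V] (hd : 0 < d)
    (hp : ∀ e, p e ≤ 2 * d / Fintype.card V) :
    (indepLaw p).real {ω | ¬ HasDiscrepancy d (edgeMatrix ω)} ≤ 1 / Fintype.card V := by
  have hunion := measureReal_not_forall_mem_le (indepLaw p) univ fun (T : Finset V) _ =>
    measureReal_not_forall_mem_le (indepLaw p) {S ∈ T.powerset | S.Nonempty} fun S hS =>
      measure_not_discrepancy_pair_le hd hp (mem_powerset.1 (mem_filter.1 hS).1)
        (mem_filter.1 hS).2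
  refine (measureReal_mono (Set.ofPred_subset_ofPred.2 fun ω hω h => hω fun S T hST hS => h T
    (mem_univ _) S (mem_filter.2 ⟨mem_powerset.2 hST, hS⟩))).trans
    (hunion.trans ((sum_le_sum fun T _ => ?_).trans sum_two_pow_card_mul_exp_le))
  rw [sum_const, nsmul_eq_mul]
  split_ifs with hT
  · simp [card_eq_zero.1 hT, filter_singleton]
  · gcongr
    exact_mod_cast (card_filter_le _ _).trans (card_powerset T).le

theorem measure_not_isRegular_le [Nonempty V] (hd : 0 < d)
    (hp : ∀ e, p e ≤ 2 * d / Fintype.card V) :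
    (indepLaw p).real {ω | ¬ IsRegular d p ω} ≤ 3 / Fintype.card V := by
  have hexp : Real.exp (-Fintype.card V) ≤ 1 / (Fintype.card V : ℝ) := by
    rw [Real.exp_neg, inv_eq_one_div]
    gcongr
    linarith [Real.add_one_le_exp (Fintype.card V : ℝ)]
  have hlight := measure_not_light_le hd hp
  have hdisc := measure_not_discrepancy_le hd hp
  refine (measureReal_mono fun ω hω => ?_).trans ((measureReal_union_le
    {ω | ¬ ∀ y ∈ latticeNet V, |lightPart √d (noise p ω) y| ≤ 40 * √d * Fintype.card V}
    {ω | ¬ HasDiscrepancy d (edgeMatrix ω)}).trans ?_)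
  · exact not_and_or.1 fun h => hω ⟨h.1, h.2⟩
  · rw [show (3 : ℝ) / Fintype.card V = 3 * (1 / Fintype.card V) by ring]
    linarith

end Regularity

/-! ### Pairs with a large product of coordinates -/

section Dyadic

lemma sum_pow_filter_le {q B : ℝ} (hq : 1 < q) (hB : 0 ≤ B) (K : ℕ) :
    ∑ i ∈ range K with q ^ i ≤ B, q ^ i ≤ q / (q - 1) * B := by
  have := sub_pos.2 hq
  induction K with
  | zero => simpa using by positivity
  | succ K ih =>
    by_cases h : q ^ K ≤ B
    · calc ∑ i ∈ range (K + 1) with q ^ i ≤ B, q ^ i ≤ ∑ i ∈ range (K + 1), q ^ i :=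
            sum_le_sum_of_subset_of_nonneg (filter_subset _ _) fun _ _ _ => by positivity
        _ = (q ^ (K + 1) - 1) / (q - 1) := geom_sum_eq hq.ne' _
        _ ≤ q ^ (K + 1) / (q - 1) := by gcongr; linarith
        _ = q / (q - 1) * q ^ K := by ring
        _ ≤ q / (q - 1) * B := by gcongr
    · rwa [range_add_one, filter_insert, if_neg h]

lemma sum_sqrt_two_pow_div_le {R : ℝ} (hR : 0 < R) (K : ℕ) :
    ∑ i ∈ range K with (2 : ℝ) ^ i ≤ 2 * R, √(2 ^ i / R) ≤ 6 := by
  have hsqrt : ∀ i : ℕ, √((2 : ℝ) ^ i) = √2 ^ i := fun i =>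
    (Real.sqrt_eq_iff_mul_self_eq_of_pos (by positivity)).2
      (by rw [← mul_pow, Real.mul_self_sqrt zero_le_two])
  have h2 : 7 / 5 ≤ √2 := Real.le_sqrt_of_sq_le (by norm_num)
  have h2' : √2 ≤ 3 / 2 := Real.sqrt_le_iff.2 ⟨by norm_num, by norm_num⟩
  have hq : √2 / (√2 - 1) ≤ 4 := by
    rw [div_le_iff₀ (by linarith)]; linarith
  calc ∑ i ∈ range K with (2 : ℝ) ^ i ≤ 2 * R, √(2 ^ i / R)
      = (∑ i ∈ range K with √2 ^ i ≤ √(2 * R), √2 ^ i) / √R := by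
        simp only [sum_div, Real.sqrt_div' _ hR.le, hsqrt]
        refine sum_congr (filter_congr fun i _ => ?_) fun _ _ => rfl
        rw [← hsqrt, Real.sqrt_le_sqrt_iff (by positivity)]
    _ ≤ 4 * (3 / 2 * √R) / √R := by
        gcongr
        refine (sum_pow_filter_le (by linarith) (Real.sqrt_nonneg _) K).trans ?_
        rw [Real.sqrt_mul zero_le_two]
        gcongr
    _ = 6 := by field_simp; norm_num

lemma one_add_pow_four_le (j : ℕ) : (1 + j) ^ 4 ≤ 64 * 2 ^ j := by
  rcases lt_or_ge j 6 with h | h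
  · interval_cases j <;> norm_num
  · induction j, h using Nat.le_induction with
    | base => norm_num
    | succ j hj ih =>
      calc (1 + (j + 1)) ^ 4 ≤ 2 * (1 + j) ^ 4 := by
            obtain ⟨k, rfl⟩ := Nat.exists_eq_add_of_le hj
            ring_nf
            nlinarith [Nat.zero_le k]
        _ ≤ 2 * (64 * 2 ^ j) := by gcongr
        _ = 64 * 2 ^ (j + 1) := by ring

lemma one_le_log_exp_one_add {x : ℝ} (hx : 0 ≤ x) : 1 ≤ Real.log (Real.exp 1 + x) := by
  rw [Real.le_log_iff_exp_le (by positivity)]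
  linarith

lemma sqrt_mul_one_add_le_log {r : ℝ} (hr : 0 < r) (hr2 : r ≤ 2) (j : ℕ) :
    √r * (1 + j) ≤ 5 * Real.log (Real.exp 1 + r ^ 2 * 4 ^ j) := by
  set θ := Real.log (Real.exp 1 + r ^ 2 * 4 ^ j)
  have hθ : 1 ≤ θ := one_le_log_exp_one_add (by positivity)
  rcases le_or_gt 1 (r ^ 2 * 2 ^ j) with h | h
  · have hlog : Real.log (2 ^ j) ≤ θ := by
      refine Real.log_le_log (by positivity) ?_
      calc (2 : ℝ) ^ j ≤ r ^ 2 * 2 ^ j * 2 ^ j := le_mul_of_one_le_left (by positivity) h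
        _ = r ^ 2 * 4 ^ j := by rw [mul_assoc, ← mul_pow]; norm_num
        _ ≤ Real.exp 1 + r ^ 2 * 4 ^ j := le_add_of_nonneg_left (Real.exp_pos 1).le
    rw [Real.log_pow] at hlog
    have hj : (j : ℝ) * (1 / 2) ≤ j * Real.log 2 := by
      gcongr
      linarith [Real.log_two_gt_d9]
    have hsr : √r ≤ 5 / 3 := Real.sqrt_le_iff.2 ⟨by norm_num, by linarith⟩
    calc √r * (1 + j) ≤ 5 / 3 * (1 + j) := by gcongr
      _ ≤ 5 * θ := by linarith
  · have hpow : (√r * (1 + j)) ^ 4 ≤ 5 ^ 4 := by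
      have h4 : √r ^ 4 = r ^ 2 := by
        rw [show √r ^ 4 = (√r ^ 2) ^ 2 by ring, Real.sq_sqrt hr.le]
      calc (√r * (1 + j)) ^ 4 = r ^ 2 * (1 + j : ℝ) ^ 4 := by rw [mul_pow, h4]
        _ ≤ r ^ 2 * (64 * 2 ^ j) := by
          gcongr
          exact_mod_cast one_add_pow_four_le j
        _ = 64 * (r ^ 2 * 2 ^ j) := by ring
        _ ≤ 5 ^ 4 := by linarith
    linarith [le_of_pow_le_pow_left₀ (by norm_num) (by norm_num) hpow]

variable {d : ℝ}

lemma two_pow_div_log_le (hd : 0 < d) {i j : ℕ} (h : (2 : ℝ) ^ i ≤ 2 * (√d * 2 ^ j)) :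
    2 ^ i / 2 ^ j / Real.log (Real.exp 1 + 4 ^ i / d) ≤
      5 * √d / (1 + j) * √(2 ^ i / (√d * 2 ^ j)) := by
  set r : ℝ := 2 ^ i / (√d * 2 ^ j) with hr
  have hr0 : 0 < r := by positivity
  have hkey := sqrt_mul_one_add_le_log hr0 (by rwa [hr, div_le_iff₀ (by positivity)]) j
  have hsq : r ^ 2 * 4 ^ j = 4 ^ i / d := by
    have hfour : ∀ m : ℕ, (4 : ℝ) ^ m = (2 ^ m) ^ 2 := fun m => by
      rw [← pow_mul, mul_comm, pow_mul]; norm_num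
    rw [hr, div_pow, mul_pow, Real.sq_sqrt hd.le, hfour, hfour]
    field_simp
  rw [hsq] at hkey
  have hθ := one_le_log_exp_one_add (x := 4 ^ i / d) (by positivity)
  rw [div_le_iff₀ (by linarith)]
  calc (2 : ℝ) ^ i / 2 ^ j = √d / (1 + j) * √r * (√r * (1 + j)) := by
        rw [show √d / (1 + j) * √r * (√r * (1 + j)) = √d * (√r * √r) by field_simp,
          Real.mul_self_sqrt hr0.le, hr]
        field_simp
    _ ≤ √d / (1 + j) * √r * (5 * Real.log (Real.exp 1 + 4 ^ i / d)) := by gcongr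
    _ = 5 * √d / (1 + j) * √r * Real.log (Real.exp 1 + 4 ^ i / d) := by ring

lemma sum_two_pow_div_log_le (hd : 0 < d) (K j : ℕ) :
    ∑ i ∈ range K with (2 : ℝ) ^ i ≤ 2 * (√d * 2 ^ j),
      2 ^ i / 2 ^ j / Real.log (Real.exp 1 + 4 ^ i / d) ≤ 30 * √d / (1 + j) := by
  calc _ ≤ ∑ i ∈ range K with (2 : ℝ) ^ i ≤ 2 * (√d * 2 ^ j),
        5 * √d / (1 + j) * √(2 ^ i / (√d * 2 ^ j)) :=
        sum_le_sum fun i hi => two_pow_div_log_le hd (mem_filter.1 hi).2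
    _ ≤ 5 * √d / (1 + j) * 6 := by
        rw [← mul_sum]
        gcongr
        exact sum_sqrt_two_pow_div_le (by positivity) K
    _ = 30 * √d / (1 + j) := by ring

lemma entropyBound_four_pow_le {α : ℝ} (hα : 0 ≤ α) (j : ℕ) :
    entropyBound (4 ^ j) α ≤ (1 + j) * (3 * α + (1 / 2) ^ j) := by
  rcases hα.eq_or_lt with rfl | hα
  · rw [entropyBound, zero_mul]; positivity
  have hlog : Real.log (4 ^ j / α) = j * (2 * Real.log 2) + Real.log α⁻¹ := by
    rw [div_eq_mul_inv, Real.log_mul (by positivity) (by positivity), Real.log_pow,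
      show (4 : ℝ) = 2 ^ 2 by norm_num, Real.log_pow, Nat.cast_two]
  have hinv : Real.log α⁻¹ ≤ α⁻¹ * Real.exp (-j) - 1 + j := by
    have h := Real.log_le_sub_one_of_pos (x := α⁻¹ * Real.exp (-j)) (by positivity)
    rw [Real.log_mul (by positivity) (by positivity), Real.log_exp] at h
    linarith
  have hexp : Real.exp (-j) ≤ (1 / 2 : ℝ) ^ j := by
    rw [neg_eq_neg_one_mul, mul_comm, Real.exp_nat_mul]
    gcongr
    rw [Real.exp_neg, one_div]
    gcongr
    linarith [Real.add_one_le_exp 1]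
  calc entropyBound (4 ^ j) α ≤ α * (1 + (j * 2 + (α⁻¹ * Real.exp (-j) - 1 + j))) := by
        rw [entropyBound, hlog]
        gcongr
        linarith [Real.log_two_lt_d9]
    _ = α * (3 * j) + Real.exp (-j) := by field_simp; ring
    _ ≤ α * (3 * j) + (1 / 2) ^ j := by gcongr
    _ ≤ (1 + j) * (3 * α + (1 / 2) ^ j) := by
        have hj : (0 : ℝ) ≤ j * (1 / 2) ^ j := by positivity
        linarith

lemma sum_entropyBound_mul_le (hd : 0 < d) {α : ℕ → ℝ} (hα : ∀ j, 0 ≤ α j) {K : ℕ}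
    (hsum : ∑ j ∈ range K, α j ≤ 4 / 3) :
    ∑ j ∈ range K, entropyBound (4 ^ j) (α j) *
      ∑ i ∈ range K with (2 : ℝ) ^ i ≤ 2 * (√d * 2 ^ j),
        2 ^ i / 2 ^ j / Real.log (Real.exp 1 + 4 ^ i / d) ≤ 180 * √d := by
  have hhalf : ∑ j ∈ range K, (1 / 2 : ℝ) ^ j ≤ 2 := by
    rw [geom_sum_eq (by norm_num), div_le_iff_of_neg (by norm_num)]
    linarith [show (0 : ℝ) ≤ (1 / 2) ^ K by positivity]
  calc _ ≤ ∑ j ∈ range K, ((1 + j) * (3 * α j + (1 / 2) ^ j)) * (30 * √d / (1 + j)) := by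
        refine sum_le_sum fun j _ => mul_le_mul (entropyBound_four_pow_le (hα j) j)
          (sum_two_pow_div_log_le hd K j) (sum_nonneg fun i _ => ?_) ?_
        · have := one_le_log_exp_one_add (x := 4 ^ i / d) (by positivity)
          positivity
        · have := hα j
          positivity
    _ = 30 * √d * (3 * ∑ j ∈ range K, α j + ∑ j ∈ range K, (1 / 2 : ℝ) ^ j) := by
        rw [mul_sum, ← sum_add_distrib, mul_sum]
        exact sum_congr rfl fun j _ => by field_simp
    _ ≤ 30 * √d * (3 * (4 / 3) + 2) := by gcongr
    _ = 180 * √d := by ring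

lemma entropyBound_mul_mul {c : ℝ} (hc : c ≠ 0) (n t : ℝ) :
    entropyBound (c * n) (c * t) = c * entropyBound n t := by
  rw [entropyBound, entropyBound, mul_div_mul_left _ _ hc, mul_assoc]

lemma entropyBound_nonneg {n t : ℝ} (ht : 0 ≤ t) (htn : t ≤ n) : 0 ≤ entropyBound n t := by
  rcases ht.eq_or_lt with rfl | ht
  · simp [entropyBound]
  · exact ht.le.trans (le_entropyBound ht htn)

/-- The first summand is the expected number of edges, the second one the entropy of the choice of
the two sets. -/
lemma mul_discrepancyBound_le {N α β x y : ℝ} (hd : 0 < d) (hN : 0 < N) (hα : 0 < α) (hα1 : α ≤ 1)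
    (hβ : 0 ≤ β) (hβ1 : β ≤ 1) (hx : 0 < x) (hy : 1 ≤ y) (hxy : √d ≤ 4 * (x * y)) :
    x * y * discrepancyBound N d (α * N / x ^ 2) (β * N / y ^ 2) ≤ 48 * √d * N * (α * β) +
      12 * N * (entropyBound (y ^ 2) β * (x / y / Real.log (Real.exp 1 + x ^ 2 / d))) := by
  have : 0 < y := by linarith
  have hmean : x * y * (12 * d * (α * N / x ^ 2) * (β * N / y ^ 2) / N) ≤
      48 * √d * N * (α * β) :=
    calc _ = 12 * √d * N * (α * β) * (√d / (x * y)) := by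
          nth_rw 1 [← Real.mul_self_sqrt hd.le]
          field_simp
      _ ≤ 12 * √d * N * (α * β) * 4 := by
          gcongr
          rwa [div_le_iff₀ (by positivity)]
      _ = 48 * √d * N * (α * β) := by ring
  have hent : entropyBound N (β * N / y ^ 2) = N / y ^ 2 * entropyBound (y ^ 2) β := by
    rw [← entropyBound_mul_mul (by positivity), div_mul_cancel₀ _ (by positivity)]
    ring_nf
  have hent0 : 0 ≤ entropyBound (y ^ 2) β := entropyBound_nonneg hβ (hβ1.trans (one_le_pow₀ hy))
  have hθ := one_le_log_exp_one_add (x := x ^ 2 / d) (by positivity)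
  have hθle : Real.log (Real.exp 1 + x ^ 2 / d) ≤
      Real.log (Real.exp 1 + N / (d * (α * N / x ^ 2))) := by
    refine Real.log_le_log (by positivity) ?_
    have hdiv : N / (d * (α * N / x ^ 2)) = x ^ 2 / d / α := by field_simp
    rw [hdiv]
    linarith [le_div_self (a := x ^ 2 / d) (by positivity) hα hα1]
  rw [discrepancyBound, mul_add, hent]
  refine add_le_add hmean ?_
  calc _ ≤ x * y * (12 * (N / y ^ 2 * entropyBound (y ^ 2) β) /
        Real.log (Real.exp 1 + x ^ 2 / d)) := by gcongr
    _ = _ := by field_simp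

end Dyadic

section Heavy

variable {V : Type*} [Fintype V] {y : V → ℝ}

/-- The vertices at which `y` is at least `2 ^ i`. -/
def level (y : V → ℝ) (i : ℕ) : Finset V := {u | 2 ^ i ≤ y u}

/-- The contribution of `level y i` to the mean square of `y`, up to a constant factor. -/
def levelMass (y : V → ℝ) (i : ℕ) : ℝ := #(level y i) * 4 ^ i / Fintype.card V

lemma level_antitone : Antitone (level y) := fun _ _ hij _ hu =>
  mem_filter.2 ⟨mem_univ _, (pow_le_pow_right₀ one_le_two hij).trans (mem_filter.1 hu).2⟩

lemma levelMass_nonneg (i : ℕ) : 0 ≤ levelMass y i := by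
  rw [levelMass]; positivity

lemma sum_levelMass_le (hy : ∑ u, y u ^ 2 ≤ Fintype.card V) (K : ℕ) :
    ∑ i ∈ range K, levelMass y i ≤ 4 / 3 := by
  have hlevel : ∑ i ∈ range K, (#(level y i) * 4 ^ i : ℝ) ≤ 4 / 3 * ∑ u, y u ^ 2 :=
    calc ∑ i ∈ range K, (#(level y i) * 4 ^ i : ℝ)
        = ∑ u, ∑ i ∈ range K with 2 ^ i ≤ y u, 4 ^ i := by
          simp only [sum_filter]
          rw [sum_comm]
          simp only [← sum_filter, sum_const, nsmul_eq_mul, level]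
      _ ≤ ∑ u, 4 / (4 - 1) * y u ^ 2 := by
          refine sum_le_sum fun u _ => (sum_le_sum_of_subset_of_nonneg (fun i hi => ?_)
            fun _ _ _ => by positivity).trans (sum_pow_filter_le (by norm_num) (sq_nonneg _) K)
          refine mem_filter.2 ⟨(mem_filter.1 hi).1, ?_⟩
          calc (4 : ℝ) ^ i = (2 ^ i) ^ 2 := by rw [← pow_mul, mul_comm, pow_mul]; norm_num
            _ ≤ y u ^ 2 := by gcongr; exact (mem_filter.1 hi).2
      _ = 4 / 3 * ∑ u, y u ^ 2 := by rw [← mul_sum]; norm_num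
  simp only [levelMass, ← sum_div]
  exact div_le_of_le_mul₀ (by positivity) (by norm_num) (hlevel.trans (by gcongr))

lemma levelMass_le_one (hy : ∑ u, y u ^ 2 ≤ Fintype.card V) (i : ℕ) : levelMass y i ≤ 1 := by
  refine div_le_one_of_le₀ (le_trans ?_ hy) (by positivity)
  calc (#(level y i) * 4 ^ i : ℝ) = ∑ u ∈ level y i, (2 ^ i) ^ 2 := by
        rw [sum_const, nsmul_eq_mul, ← pow_mul, mul_comm i, pow_mul]; norm_num
    _ ≤ ∑ u ∈ level y i, y u ^ 2 := by
        gcongr with u hu; exact (mem_filter.1 hu).2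
    _ ≤ ∑ u, y u ^ 2 := sum_le_univ_sum_of_nonneg fun _ => sq_nonneg _

variable {d : ℝ} {E : Matrix V V ℝ}

lemma HasDiscrepancy.mul_sum_level_le (hE : HasDiscrepancy d E) (hd : 0 < d)
    (hy : ∑ u, y u ^ 2 ≤ Fintype.card V) {i j : ℕ} (hji : j ≤ i) (hij : √d ≤ 4 * (2 ^ i * 2 ^ j)) :
    2 ^ i * 2 ^ j * ∑ u ∈ level y i, ∑ v ∈ level y j, E u v ≤
      48 * √d * Fintype.card V * (levelMass y i * levelMass y j) +
        12 * Fintype.card V * (entropyBound (4 ^ j) (levelMass y j) *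
          (2 ^ i / 2 ^ j / Real.log (Real.exp 1 + 4 ^ i / d))) := by
  have hmass := levelMass_le_one hy
  have hfour : ∀ m : ℕ, (4 : ℝ) ^ m = (2 ^ m) ^ 2 := fun m => by
    rw [← pow_mul, mul_comm, pow_mul]; norm_num
  rcases (level y i).eq_empty_or_nonempty with h | h
  · have := levelMass_nonneg (y := y) i
    have := levelMass_nonneg (y := y) j
    have := one_le_log_exp_one_add (x := 4 ^ i / d) (by positivity)
    have := entropyBound_nonneg (levelMass_nonneg j)
      ((hmass j).trans (one_le_pow₀ (n := j) (by norm_num : (1 : ℝ) ≤ 4)))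
    rw [h, sum_empty, mul_zero]
    positivity
  · have : Nonempty V := ⟨h.choose⟩
    have hcard : ∀ m, (#(level y m) : ℝ) = levelMass y m * Fintype.card V / (2 ^ m) ^ 2 :=
      fun m => by rw [levelMass, hfour]; field_simp
    have hpos : 0 < levelMass y i := by
      have := h.card_pos
      rw [levelMass]
      positivity
    calc _ ≤ 2 ^ i * 2 ^ j * discrepancyBound (Fintype.card V) d #(level y i) #(level y j) := by
          gcongr
          exact hE _ _ (level_antitone hji) h
      _ ≤ _ := by
          rw [hcard i, hcard j, hfour j, hfour i]
          exact mul_discrepancyBound_le hd (by positivity) hpos (hmass i) (levelMass_nonneg j)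
            (hmass j) (by positivity) (one_le_pow₀ one_le_two) hij

/-- The exponents `(i, j)` of the dyadic levels on which a product of coordinates above `√d` with
a ratio between `1` and `√d` can lie. -/
def levelPairs (d : ℝ) (K : ℕ) : Finset (ℕ × ℕ) :=
  {z ∈ range K ×ˢ range K | z.2 ≤ z.1 ∧ (2 : ℝ) ^ z.1 ≤ 2 * (√d * 2 ^ z.2) ∧
    √d ≤ 4 * (2 ^ z.1 * 2 ^ z.2)}

lemma HasDiscrepancy.sum_levelPairs_le (hE : HasDiscrepancy d E) (hd : 0 < d)
    (hy : ∑ u, y u ^ 2 ≤ Fintype.card V) (K : ℕ) :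
    ∑ z ∈ levelPairs d K, 2 ^ z.1 * 2 ^ z.2 * ∑ u ∈ level y z.1, ∑ v ∈ level y z.2, E u v ≤
      2250 * √d * Fintype.card V := by
  have hmass : ∑ z ∈ levelPairs d K, levelMass y z.1 * levelMass y z.2 ≤ 16 / 9 :=
    calc _ ≤ ∑ z ∈ range K ×ˢ range K, levelMass y z.1 * levelMass y z.2 :=
          sum_le_sum_of_subset_of_nonneg (filter_subset _ _) fun _ _ _ =>
            mul_nonneg (levelMass_nonneg _) (levelMass_nonneg _)
      _ = (∑ i ∈ range K, levelMass y i) * ∑ j ∈ range K, levelMass y j := by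
          rw [sum_mul_sum, sum_product]
      _ ≤ 4 / 3 * (4 / 3) := by
          gcongr
          exacts [sum_nonneg fun _ _ => levelMass_nonneg _, sum_levelMass_le hy K,
            sum_levelMass_le hy K]
      _ = 16 / 9 := by norm_num
  have hent : ∑ z ∈ levelPairs d K, entropyBound (4 ^ z.2) (levelMass y z.2) *
      (2 ^ z.1 / 2 ^ z.2 / Real.log (Real.exp 1 + 4 ^ z.1 / d)) ≤ 180 * √d := by
    refine le_trans ?_ (sum_entropyBound_mul_le hd levelMass_nonneg (sum_levelMass_le hy K))
    simp only [mul_sum, sum_filter, mul_ite, mul_zero, ← sum_product_right']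
    rw [← sum_filter]
    refine sum_le_sum_of_subset_of_nonneg
      (monotone_filter_right _ fun z _ hz => hz.2.1) fun z _ _ => ?_
    have := one_le_log_exp_one_add (x := 4 ^ z.1 / d) (by positivity)
    have := entropyBound_nonneg (levelMass_nonneg (y := y) z.2)
      ((levelMass_le_one hy z.2).trans (one_le_pow₀ (n := z.2) (by norm_num : (1 : ℝ) ≤ 4)))
    positivity
  calc _ ≤ ∑ z ∈ levelPairs d K, (48 * √d * Fintype.card V * (levelMass y z.1 * levelMass y z.2) +
        12 * Fintype.card V * (entropyBound (4 ^ z.2) (levelMass y z.2) *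
          (2 ^ z.1 / 2 ^ z.2 / Real.log (Real.exp 1 + 4 ^ z.1 / d)))) := by
        refine sum_le_sum fun z hz => ?_
        obtain ⟨-, hji, -, hij⟩ := mem_filter.1 hz
        exact hE.mul_sum_level_le hd hy hji hij
    _ ≤ 48 * √d * Fintype.card V * (16 / 9) + 12 * Fintype.card V * (180 * √d) := by
        rw [sum_add_distrib, ← mul_sum, ← mul_sum]
        gcongr
    _ ≤ 2250 * √d * Fintype.card V := by
        have : 0 ≤ √d * Fintype.card V := by positivity
        linarith

lemma exists_levelPair {x y : ℝ} (hy : 0 ≤ y) (hyx : y ≤ x) (hd : √d < x * y)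
    (hx : x ≤ √d * y) {K : ℕ} (hK : x < K) : ∃ z ∈ levelPairs d K,
      2 ^ z.1 ≤ x ∧ 2 ^ z.2 ≤ y ∧ x * y ≤ 4 * (2 ^ z.1 * 2 ^ z.2) := by
  have hy1 : 1 ≤ y := by
    by_contra! h
    nlinarith [Real.sqrt_nonneg d]
  obtain ⟨i, hi, hi'⟩ := exists_nat_pow_near (hy1.trans hyx) one_lt_two
  obtain ⟨j, hj, hj'⟩ := exists_nat_pow_near hy1 one_lt_two
  have hlt : ∀ m : ℕ, (2 : ℝ) ^ m ≤ x → m < K := fun m hm => by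
    have : (m : ℝ) < 2 ^ m := mod_cast m.lt_two_pow_self
    exact_mod_cast this.trans_le (hm.trans hK.le)
  have hprod : x * y ≤ 4 * (2 ^ i * 2 ^ j) :=
    calc x * y ≤ 2 ^ (i + 1) * 2 ^ (j + 1) := by gcongr
      _ = 4 * (2 ^ i * 2 ^ j) := by ring
  have hji : j ≤ i := Nat.lt_succ_iff.1 <|
    (pow_lt_pow_iff_right₀ one_lt_two).1 (hj.trans_lt (hyx.trans_lt hi'))
  have hratio : (2 : ℝ) ^ i ≤ 2 * (√d * 2 ^ j) :=
    calc (2 : ℝ) ^ i ≤ √d * 2 ^ (j + 1) := hi.trans (hx.trans (by gcongr))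
      _ = 2 * (√d * 2 ^ j) := by ring
  refine ⟨(i, j), mem_filter.2 ⟨mem_product.2 ⟨?_, ?_⟩, hji, hratio, hd.le.trans hprod⟩,
    hi, hj, hprod⟩
  exacts [mem_range.2 (hlt i hi), mem_range.2 (hlt j (hj.trans hyx))]

lemma heavyPart_le_two_mul {c : ℝ} (hE0 : ∀ u v, 0 ≤ E u v) (hE : ∀ u v, E u v = E v u)
    (hy0 : ∀ u, 0 ≤ y u) : heavyPart c E y ≤
      2 * ∑ u, ∑ v, (if c < y u * y v ∧ y v ≤ y u then y u * y v else 0) * E u v := by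
  set w : V → V → ℝ := fun u v => if c < y u * y v ∧ y v ≤ y u then y u * y v else 0
  have hw : ∀ u v, 0 ≤ w u v := fun u v => by
    have := mul_nonneg (hy0 u) (hy0 v)
    positivity
  have hsplit : ∀ u v, (if c < |y u * y v| then y u * y v else 0) ≤ w u v + w v u := fun u v => by
    rw [abs_of_nonneg (mul_nonneg (hy0 u) (hy0 v))]
    split_ifs with h
    · rcases le_total (y v) (y u) with hvu | huv
      · linarith [hw v u, show w u v = y u * y v from if_pos ⟨h, hvu⟩]
      · linarith [hw u v, show w v u = y v * y u from if_pos ⟨by rwa [mul_comm], huv⟩,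
          mul_comm (y u) (y v)]
    · exact add_nonneg (hw u v) (hw v u)
  calc heavyPart c E y ≤ ∑ u, ∑ v, (w u v + w v u) * E u v :=
        sum_le_sum fun u _ => sum_le_sum fun v _ =>
          mul_le_mul_of_nonneg_right (hsplit u v) (hE0 u v)
    _ = ∑ u, ∑ v, w u v * E u v + ∑ u, ∑ v, w u v * E u v := by
        simp only [add_mul, sum_add_distrib]
        congr 1
        rw [sum_comm]
        simp only [hE]
    _ = 2 * ∑ u, ∑ v, w u v * E u v := (two_mul _).symm

lemma mul_le_sq_div_add_sum_levelPairs (hd : 0 < d) {x y : ℝ} (hy : 0 ≤ y) {K : ℕ} (hx : x < K) :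
    (if √d < x * y ∧ y ≤ x then x * y else 0) ≤
      x ^ 2 / √d + 4 * ∑ z ∈ levelPairs d K with 2 ^ z.1 ≤ x ∧ 2 ^ z.2 ≤ y, 2 ^ z.1 * 2 ^ z.2 := by
  have hsum : (0 : ℝ) ≤
    4 * ∑ z ∈ levelPairs d K with 2 ^ z.1 ≤ x ∧ 2 ^ z.2 ≤ y, 2 ^ z.1 * 2 ^ z.2 := by positivity
  split_ifs with h
  · rcases le_or_gt x (√d * y) with hxy | hxy
    · obtain ⟨z, hz, hzx, hzy, hle⟩ := exists_levelPair hy h.2 h.1 hxy hx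
      have hmem : (2 : ℝ) ^ z.1 * 2 ^ z.2 ≤
          ∑ z ∈ levelPairs d K with 2 ^ z.1 ≤ x ∧ 2 ^ z.2 ≤ y, 2 ^ z.1 * 2 ^ z.2 :=
        single_le_sum (f := fun z : ℕ × ℕ => (2 : ℝ) ^ z.1 * 2 ^ z.2)
          (fun _ _ => by positivity) (mem_filter.2 ⟨hz, hzx, hzy⟩)
      have : 0 ≤ x ^ 2 / √d := by positivity
      linarith
    · have : x * y ≤ x ^ 2 / √d := by
        rw [le_div_iff₀ (Real.sqrt_pos.2 hd)]
        nlinarith [hy.trans h.2]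
      linarith
  · positivity

lemma sum_sum_mul_levelPairs (E : Matrix V V ℝ) (y : V → ℝ) (K : ℕ) :
    ∑ u, ∑ v, (∑ z ∈ levelPairs d K with 2 ^ z.1 ≤ y u ∧ 2 ^ z.2 ≤ y v, 2 ^ z.1 * 2 ^ z.2) * E u v =
      ∑ z ∈ levelPairs d K, 2 ^ z.1 * 2 ^ z.2 * ∑ u ∈ level y z.1, ∑ v ∈ level y z.2, E u v := by
  simp only [sum_mul, sum_filter]
  rw [sum_congr rfl fun u _ => sum_comm, sum_comm]
  refine sum_congr rfl fun z _ => ?_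
  simp only [level, sum_filter, mul_sum]
  refine sum_congr rfl fun u _ => ?_
  by_cases hu : 2 ^ z.1 ≤ y u <;> simp [hu, mul_sum]

lemma HasDiscrepancy.heavyPart_le_of_nonneg (hE : HasDiscrepancy d E) (hd : 0 < d)
    (hE0 : ∀ u v, 0 ≤ E u v) (hsymm : ∀ u v, E u v = E v u) (hy0 : ∀ u, 0 ≤ y u)
    (hy : ∑ u, y u ^ 2 ≤ Fintype.card V) (hdeg : ∀ u, y u ≠ 0 → ∑ v, E u v ≤ 20 * d) :
    heavyPart √d E y ≤ 18040 * √d * Fintype.card V := by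
  obtain ⟨K, hK⟩ : ∃ K : ℕ, ∀ u, y u < K := by
    obtain ⟨K, hK⟩ := exists_nat_gt (∑ u, y u)
    exact ⟨K, fun u => (single_le_sum (fun v _ => hy0 v) (mem_univ u)).trans_lt hK⟩
  have hdegree : ∑ u, ∑ v, y u ^ 2 / √d * E u v ≤ 20 * √d * Fintype.card V :=
    calc ∑ u, ∑ v, y u ^ 2 / √d * E u v ≤ ∑ u, y u ^ 2 / √d * (20 * d) := by
          refine sum_le_sum fun u _ => ?_
          rw [← mul_sum]
          rcases eq_or_ne (y u) 0 with h | h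
          · simp [h]
          · exact mul_le_mul_of_nonneg_left (hdeg u h) (by positivity)
      _ = 20 * √d * ∑ u, y u ^ 2 := by
          rw [← sum_mul, ← sum_div]
          nth_rw 2 [← Real.mul_self_sqrt hd.le]
          field_simp
      _ ≤ 20 * √d * Fintype.card V := by gcongr
  have hlevels := hE.sum_levelPairs_le hd hy K
  rw [← sum_sum_mul_levelPairs] at hlevels
  calc heavyPart √d E y
      ≤ 2 * ∑ u, ∑ v, (if √d < y u * y v ∧ y v ≤ y u then y u * y v else 0) * E u v :=
        heavyPart_le_two_mul hE0 hsymm hy0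
    _ ≤ 2 * ∑ u, ∑ v, (y u ^ 2 / √d + 4 * ∑ z ∈ levelPairs d K with
          2 ^ z.1 ≤ y u ∧ 2 ^ z.2 ≤ y v, 2 ^ z.1 * 2 ^ z.2) * E u v := by
        gcongr with u _ v _
        exacts [hE0 u v, mul_le_sq_div_add_sum_levelPairs hd (hy0 v) (hK u)]
    _ ≤ 2 * (20 * √d * Fintype.card V + 4 * (2250 * √d * Fintype.card V)) := by
        simp only [add_mul, sum_add_distrib]
        gcongr
        simpa only [mul_assoc (4 : ℝ) (Finset.sum _ _), ← mul_sum _ _ (4 : ℝ)] using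
          mul_le_mul_of_nonneg_left hlevels zero_le_four
    _ = 18040 * √d * Fintype.card V := by ring

lemma abs_heavyPart_le (c : ℝ) (hE0 : ∀ u v, 0 ≤ E u v) (y : V → ℝ) :
    |heavyPart c E y| ≤ heavyPart c E |y| := by
  refine (abs_sum_le_sum_abs _ _).trans (sum_le_sum fun u _ =>
    (abs_sum_le_sum_abs _ _).trans (sum_le_sum fun v _ => ?_))
  rw [abs_mul, abs_of_nonneg (hE0 u v), Pi.abs_apply, Pi.abs_apply, ← abs_mul, abs_abs]
  gcongr
  · exact hE0 u v
  · split_ifs <;> simp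

/-- Pairs with a product of coordinates above `√d` are too sensitive to the noise for a union bound;
their edges are counted by means of the discrepancy property. -/
lemma HasDiscrepancy.abs_heavyPart_le (hE : HasDiscrepancy d E) (hd : 0 < d)
    (hE0 : ∀ u v, 0 ≤ E u v) (hsymm : ∀ u v, E u v = E v u)
    (hy : ∑ u, y u ^ 2 ≤ Fintype.card V) (hdeg : ∀ u, y u ≠ 0 → ∑ v, E u v ≤ 20 * d) :
    |heavyPart √d E y| ≤ 18040 * √d * Fintype.card V :=
  (SpectralSBM.abs_heavyPart_le _ hE0 y).trans <|
    hE.heavyPart_le_of_nonneg hd hE0 hsymm (fun u => abs_nonneg _) (by simpa using hy)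
      fun u hu => hdeg u (by simpa using hu)

end Heavy

/-! ### Concentration of the trimmed matrix -/

section Net

variable {V : Type*} [Fintype V]

lemma quadForm_smul (M : Matrix V V ℝ) (c : ℝ) (x : V → ℝ) :
    quadForm M (c • x) = c ^ 2 * quadForm M x := by
  simp only [quadForm, Pi.smul_apply, smul_eq_mul, mul_sum]
  exact sum_congr rfl fun u _ => sum_congr rfl fun v _ => by ring

lemma quadForm_polarization (M : Matrix V V ℝ) (x r : V → ℝ) :
    8 * (quadForm M (x + r) - quadForm M x - quadForm M r) =
      quadForm M (x + (4 : ℝ) • r) - quadForm M (x - (4 : ℝ) • r) := by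
  simp only [quadForm, Pi.add_apply, Pi.sub_apply, Pi.smul_apply, smul_eq_mul, mul_sum,
    ← sum_sub_distrib]
  exact sum_congr rfl fun u _ => sum_congr rfl fun v _ => by ring

lemma abs_quadForm_le_of_forall_ball {M : Matrix V V ℝ} {r m : ℝ} (hr : 0 < r)
    (h : ∀ x : V → ℝ, ∑ u, x u ^ 2 ≤ r → |quadForm M x| ≤ m) (x : V → ℝ) :
    |quadForm M x| ≤ m / r * ∑ u, x u ^ 2 := by
  rcases (sum_nonneg fun u _ => sq_nonneg (x u) : 0 ≤ ∑ u, x u ^ 2).eq_or_lt with hx | hx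
  · have hx0 : ∀ u, x u = 0 := fun u => by
      simpa using (sum_eq_zero_iff_of_nonneg fun u _ => sq_nonneg (x u)).1 hx.symm u (mem_univ u)
    simp [quadForm, hx0]
  · have hscale : √(r / ∑ u, x u ^ 2) ^ 2 = r / ∑ u, x u ^ 2 := Real.sq_sqrt (by positivity)
    have hball := h (√(r / ∑ u, x u ^ 2) • x) <| by
      simp only [Pi.smul_apply, smul_eq_mul, mul_pow, ← mul_sum, hscale]
      rw [div_mul_cancel₀ _ hx.ne']
    rw [quadForm_smul, hscale, abs_mul, abs_of_pos (by positivity), div_mul_eq_mul_div,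
      div_le_iff₀ hx] at hball
    rw [div_mul_eq_mul_div, le_div_iff₀ hr]
    linarith

lemma exists_abs_quadForm_le (M : Matrix V V ℝ) {r : ℝ} (hr : 0 < r) :
    ∃ x₀ : V → ℝ, ∑ u, x₀ u ^ 2 ≤ r ∧
      ∀ x : V → ℝ, |quadForm M x| ≤ |quadForm M x₀| / r * ∑ u, x u ^ 2 := by
  have hcompact : IsCompact {x : V → ℝ | ∑ u, x u ^ 2 ≤ r} := by
    refine (isCompact_univ_pi fun _ : V => isCompact_Icc (a := -√r) (b := √r)).of_isClosed_subset
      (isClosed_le (by fun_prop) continuous_const) fun x hx u _ => abs_le.1 ?_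
    exact Real.abs_le_sqrt ((single_le_sum (f := fun u => x u ^ 2) (fun _ _ => sq_nonneg _)
      (mem_univ u)).trans hx)
  obtain ⟨x₀, hx₀, hmax⟩ := hcompact.exists_isMaxOn (f := fun x => |quadForm M x|)
    ⟨0, by simpa using hr.le⟩ (by unfold quadForm; fun_prop)
  exact ⟨x₀, hx₀, abs_quadForm_le_of_forall_ball hr fun x hx => hmax hx⟩

lemma exists_int_near (t : ℝ) : ∃ z : ℤ, (z : ℝ) ^ 2 ≤ t ^ 2 ∧ (t - z) ^ 2 ≤ 1 := by
  rcases le_total 0 t with h | h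
  · have hfloor : (0 : ℝ) ≤ ⌊t⌋ := mod_cast Int.floor_nonneg.2 h
    exact ⟨⌊t⌋, by nlinarith [Int.floor_le t],
      by nlinarith [Int.floor_le t, Int.lt_floor_add_one t]⟩
  · have hceil : ((⌈t⌉ : ℤ) : ℝ) ≤ 0 := mod_cast Int.ceil_le.2 (by simpa using h)
    exact ⟨⌈t⌉, by nlinarith [Int.le_ceil t],
      by nlinarith [Int.le_ceil t, Int.ceil_lt_add_one t]⟩

lemma exists_latticeNet_near {x : V → ℝ} (hx : ∑ u, x u ^ 2 ≤ Fintype.card V) :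
    ∃ y ∈ latticeNet V, ∃ r, y + r = x ∧ ∑ u, r u ^ 2 ≤ (Fintype.card V : ℝ) / 16 := by
  choose z hz hxz using fun u => exists_int_near (4 * x u)
  refine ⟨_, int_div_four_mem_latticeNet (z := z) ?_, _, add_sub_cancel _ _, ?_⟩
  · have hsum : ∑ u, (z u : ℝ) ^ 2 ≤ 16 * Fintype.card V :=
      calc ∑ u, (z u : ℝ) ^ 2 ≤ ∑ u, (4 * x u) ^ 2 := sum_le_sum fun u _ => hz u
        _ = 16 * ∑ u, x u ^ 2 := by simp only [mul_pow, ← mul_sum]; norm_num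
        _ ≤ 16 * Fintype.card V := by gcongr
    exact_mod_cast hsum
  · calc ∑ u, (x u - z u / 4) ^ 2 ≤ ∑ _u : V, (1 / 16 : ℝ) :=
          sum_le_sum fun u _ => by linarith [hxz u]
      _ = Fintype.card V / 16 := by simp [div_eq_mul_inv]

/-- A maximizer `x₀` of `|quadForm M|` on the ball is a net point `y` plus a short remainder `r`,
and by polarization the cross terms only cost a fraction of the maximum. -/
lemma abs_quadForm_le_of_forall_latticeNet [Nonempty V] {M : Matrix V V ℝ} {c : ℝ}
    (h : ∀ y ∈ latticeNet V, |quadForm M y| ≤ c * Fintype.card V) (x : V → ℝ) :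
    |quadForm M x| ≤ 3 * c * ∑ u, x u ^ 2 := by
  set N : ℝ := (Fintype.card V : ℝ)
  have hN : 0 < N := by positivity
  obtain ⟨x₀, hx₀, hmax⟩ := exists_abs_quadForm_le M hN
  set m := |quadForm M x₀|
  obtain ⟨y, hy, r, hyr, hr⟩ := exists_latticeNet_near hx₀
  have hparallel : ∑ u, (y + (4 : ℝ) • r) u ^ 2 + ∑ u, (y - (4 : ℝ) • r) u ^ 2 ≤ 4 * N :=
    calc _ = 2 * ∑ u, y u ^ 2 + 32 * ∑ u, r u ^ 2 := by
          simp only [mul_sum, ← sum_add_distrib, Pi.add_apply, Pi.sub_apply, Pi.smul_apply,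
            smul_eq_mul]
          exact sum_congr rfl fun u _ => by ring
      _ ≤ 2 * N + 32 * (N / 16) := by
          gcongr
          exact sum_sq_le_of_mem_latticeNet hy
      _ = 4 * N := by ring
  have hcross : 8 * |quadForm M x₀ - quadForm M y - quadForm M r| ≤ 4 * m :=
    calc _ = |quadForm M (y + (4 : ℝ) • r) - quadForm M (y - (4 : ℝ) • r)| := by
          rw [← quadForm_polarization, hyr, abs_mul]; norm_num
      _ ≤ m / N * ∑ u, (y + (4 : ℝ) • r) u ^ 2 + m / N * ∑ u, (y - (4 : ℝ) • r) u ^ 2 :=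
          (abs_sub _ _).trans (add_le_add (hmax _) (hmax _))
      _ ≤ m / N * (4 * N) := by rw [← mul_add]; gcongr
      _ = 4 * m := by field_simp
  have hrem : |quadForm M r| ≤ m / 16 :=
    calc _ ≤ m / N * (N / 16) := (hmax r).trans (by gcongr)
      _ = m / 16 := by field_simp
  have hm : m ≤ 3 * c * N := by
    have htri := abs_add_three (quadForm M x₀ - quadForm M y - quadForm M r) (quadForm M r)
      (quadForm M y)
    rw [sub_add_cancel, sub_add_cancel] at htri
    linarith [h y hy, abs_nonneg (quadForm M y)]
  refine (hmax x).trans ?_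
  gcongr
  rwa [div_le_iff₀ hN]

end Net

section Concentration

variable {V : Type*}

open Classical in
/-- The matrix `M` with the rows and columns outside `L` zeroed out. -/
def restrict (L : Set V) (M : Matrix V V ℝ) : Matrix V V ℝ :=
  Matrix.of fun u v => if u ∈ L ∧ v ∈ L then M u v else 0

lemma abs_meanMatrix_le [DecidableEq V] {p : Sym2 V → unitInterval} {q : ℝ}
    (hp : ∀ e, p e ≤ q) (u v : V) : |meanMatrix p u v| ≤ q := by
  rw [abs_of_nonneg (meanMatrix_nonneg p u v), meanMatrix, Matrix.of_apply]
  split_ifs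
  exacts [(p s(u, v)).2.1.trans (hp _), hp _]

variable [Fintype V]

lemma quadForm_restrict (L : Set V) (M : Matrix V V ℝ) (x : V → ℝ) :
    quadForm (restrict L M) x = quadForm M (L.indicator x) := by
  refine sum_congr rfl fun u _ => sum_congr rfl fun v _ => ?_
  by_cases hu : u ∈ L <;> by_cases hv : v ∈ L <;> simp [restrict, hu, hv]

lemma heavyPart_sub (c : ℝ) (M M' : Matrix V V ℝ) (x : V → ℝ) :
    heavyPart c (M - M') x = heavyPart c M x - heavyPart c M' x := by
  simp only [heavyPart, Matrix.sub_apply, mul_sub, sum_sub_distrib]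

lemma abs_heavyPart_le_of_abs_le {c q : ℝ} (hc : 0 < c) {M : Matrix V V ℝ}
    (hM : ∀ u v, |M u v| ≤ q) (x : V → ℝ) :
    |heavyPart c M x| ≤ q / c * (∑ u, x u ^ 2) ^ 2 :=
  calc |heavyPart c M x| ≤ ∑ u, ∑ v, q / c * (x u ^ 2 * x v ^ 2) := by
        refine (abs_sum_le_sum_abs _ _).trans (sum_le_sum fun u _ =>
          (abs_sum_le_sum_abs _ _).trans (sum_le_sum fun v _ => ?_))
        have hq : 0 ≤ q := (abs_nonneg _).trans (hM u v)
        split_ifs with h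
        · calc |x u * x v * M u v| ≤ |x u * x v| * q := by
                rw [abs_mul]
                gcongr
                exact hM u v
            _ ≤ |x u * x v| * q * (|x u * x v| / c) :=
                le_mul_of_one_le_right (by positivity) ((one_le_div hc).2 h.le)
            _ = q / c * |x u * x v| ^ 2 := by ring
            _ = q / c * (x u ^ 2 * x v ^ 2) := by rw [sq_abs, mul_pow]
        · rw [zero_mul, abs_zero]; positivity
    _ = q / c * (∑ u, x u ^ 2) ^ 2 := by
        simp only [← mul_sum]
        rw [sq, sum_mul_sum]
        simp only [mul_sum]

variable [DecidableEq V] {d : ℝ} {p : Sym2 V → unitInterval} {ω : Sym2 V → Prop}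

/-- The vertices that survive the trimming: those of degree at most `20 * d`. -/
def lowDegree (d : ℝ) (ω : Sym2 V → Prop) : Finset V := {u | ∑ v, edgeMatrix ω u v ≤ 20 * d}

lemma IsRegular.abs_quadForm_le_of_mem_latticeNet (hω : IsRegular d p ω) (hd : 0 < d)
    (hp : ∀ e, p e ≤ 2 * d / Fintype.card V) {y : V → ℝ} (hy : y ∈ latticeNet V)
    (hlow : ∀ u, y u ≠ 0 → u ∈ lowDegree d ω) :
    |quadForm (noise p ω) y| ≤ 18082 * √d * Fintype.card V := by
  have hsq := sum_sq_le_of_mem_latticeNet hy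
  have hedge : |heavyPart √d (edgeMatrix ω) y| ≤ 18040 * √d * Fintype.card V :=
    hω.discrepancy.abs_heavyPart_le hd (edgeMatrix_nonneg ω) (edgeMatrix_comm ω) hsq
      fun u hu => mem_filter_univ u |>.1 (hlow u hu)
  have hmean : |heavyPart √d (meanMatrix p) y| ≤ 2 * √d * Fintype.card V :=
    calc _ ≤ 2 * d / Fintype.card V / √d * (∑ u, y u ^ 2) ^ 2 :=
          abs_heavyPart_le_of_abs_le (Real.sqrt_pos.2 hd) (abs_meanMatrix_le hp) y
      _ ≤ 2 * d / Fintype.card V / √d * (Fintype.card V : ℝ) ^ 2 := by gcongr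
      _ = 2 * √d * Fintype.card V := by
          nth_rw 1 [← Real.mul_self_sqrt hd.le]
          field_simp
  rw [← lightPart_add_heavyPart √d, noise, heavyPart_sub]
  have hsplit := abs_add_le (lightPart √d (noise p ω) y)
    (heavyPart √d (edgeMatrix ω) y - heavyPart √d (meanMatrix p) y)
  have hdiff := abs_sub (heavyPart √d (edgeMatrix ω) y) (heavyPart √d (meanMatrix p) y)
  rw [noise] at hsplit
  have := hω.light y hy
  rw [noise] at this
  linarith

lemma IsRegular.abs_quadForm_restrict_noise_le [Nonempty V] (hω : IsRegular d p ω) (hd : 0 < d)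
    (hp : ∀ e, p e ≤ 2 * d / Fintype.card V) (x : V → ℝ) :
    |quadForm (restrict (lowDegree d ω) (noise p ω)) x| ≤ 54246 * √d * ∑ u, x u ^ 2 := by
  refine (abs_quadForm_le_of_forall_latticeNet (c := 18082 * √d) (fun y hy => ?_) x).trans_eq
    (by ring)
  rw [quadForm_restrict]
  exact hω.abs_quadForm_le_of_mem_latticeNet hd hp (indicator_mem_latticeNet _ hy)
    fun u hu => Set.mem_of_indicator_ne_zero hu

end Concentration

/-! ### The span of two top eigenvectors -/

section TopEigenvectors

variable {E : Type*} [NormedAddCommGroup E] [InnerProductSpace ℝ E]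

lemma exists_unit_mem_inner_eq_zero {W : Submodule ℝ E} (hW : 1 < Module.finrank ℝ W) (v : E) :
    ∃ w ∈ W, ‖w‖ = 1 ∧ inner ℝ v w = 0 := by
  have : FiniteDimensional ℝ W := Module.finite_of_finrank_pos (zero_lt_one.trans hW)
  have hker : ((innerₗ E v).domRestrict W).ker ≠ ⊥ :=
    LinearMap.ker_ne_bot_of_finrank_lt (by rwa [Module.finrank_self])
  obtain ⟨w, hw, hw0⟩ := Submodule.exists_mem_ne_zero_of_ne_bot hker
  refine ⟨(‖w‖⁻¹ : ℝ) • w, W.smul_mem _ w.2, norm_smul_inv_norm (by simpa using hw0), ?_⟩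
  rw [real_inner_smul_right, show inner ℝ v (w : E) = 0 from hw, mul_zero]

variable {κ ι : Type*} [Fintype κ] [Fintype ι] {T : E →ₗ[ℝ] E} {lam : κ → ℝ}
  {u : OrthonormalBasis κ ℝ E} {f : ι → E}

lemma sum_inner_map_self (hT : ∀ k, T (u k) = lam k • u k) :
    ∑ i, inner ℝ (f i) (T (f i)) = ∑ k, lam k * ∑ i, inner ℝ (u k) (f i) ^ 2 := by
  have hmap : ∀ x, T x = ∑ k, inner ℝ (u k) x • lam k • u k := fun x => by
    conv_lhs => rw [← u.sum_repr' x]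
    simp only [map_sum, map_smul, hT]
  simp only [hmap, inner_sum, mul_sum]
  rw [sum_comm]
  refine sum_congr rfl fun k _ => sum_congr rfl fun i _ => ?_
  rw [real_inner_smul_right, real_inner_smul_right, real_inner_comm]
  ring

lemma sum_inner_sq_le_one (hf : Orthonormal ℝ f) (u : OrthonormalBasis κ ℝ E) (k : κ) :
    ∑ i, inner ℝ (u k) (f i) ^ 2 ≤ 1 := by
  simpa [real_inner_comm] using hf.sum_inner_products_le (s := univ) (u k)

lemma sum_sum_inner_sq (hf : Orthonormal ℝ f) (u : OrthonormalBasis κ ℝ E) :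
    ∑ k, ∑ i, inner ℝ (u k) (f i) ^ 2 = Fintype.card ι := by
  have hparseval : ∀ i, ∑ k, inner ℝ (u k) (f i) ^ 2 = 1 := fun i => by
    simpa [hf.1 i] using u.sum_sq_norm_inner_right (f i)
  rw [sum_comm, sum_congr rfl fun i _ => hparseval i]
  simp

variable {K : Finset κ}

/-- Ky Fan's maximum principle. -/
lemma sum_inner_map_self_le (hT : ∀ k, T (u k) = lam k • u k) (hf : Orthonormal ℝ f)
    (hK : #K = Fintype.card ι) {t : ℝ} (ht : ∀ k ∈ K, t ≤ lam k) (ht' : ∀ k ∉ K, lam k ≤ t) :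
    ∑ i, inner ℝ (f i) (T (f i)) ≤ ∑ k ∈ K, lam k := by
  classical
  rw [sum_inner_map_self hT]
  calc ∑ k, lam k * ∑ i, inner ℝ (u k) (f i) ^ 2
      = ∑ k, (lam k - t) * ∑ i, inner ℝ (u k) (f i) ^ 2 + t * #K := by
        simp only [sub_mul, sum_sub_distrib, ← mul_sum _ _ t, sum_sum_inner_sq hf u, hK,
          sub_add_cancel]
    _ ≤ ∑ k, (if k ∈ K then lam k - t else 0) + t * #K := by
        gcongr with k
        split_ifs with hk
        · exact mul_le_of_le_one_right (sub_nonneg.2 (ht k hk)) (sum_inner_sq_le_one hf u k)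
        · exact mul_nonpos_of_nonpos_of_nonneg (sub_nonpos.2 (ht' k hk))
            (sum_nonneg fun _ _ => sq_nonneg _)
    _ = ∑ k ∈ K, lam k := by
        simp [sum_ite_mem, mul_comm t]

lemma sum_inner_map_self_eq (hT : ∀ k, T (u k) = lam k • u k) (hf : Orthonormal ℝ f)
    (hK : #K = Fintype.card ι) (hmem : ∀ i, f i ∈ Submodule.span ℝ (u '' K)) :
    ∑ i, inner ℝ (f i) (T (f i)) = ∑ k ∈ K, lam k := by
  have hnotMem : ∀ k ∉ K, ∑ i, inner ℝ (u k) (f i) ^ 2 = 0 := fun k hk => by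
    have hle : Submodule.span ℝ (u '' K) ≤ (ℝ ∙ u k)ᗮ := by
      rw [Submodule.span_le]
      rintro _ ⟨l, hl, rfl⟩
      exact Submodule.mem_orthogonal_singleton_iff_inner_right.2
        (u.inner_eq_zero fun h => hk (h ▸ hl))
    refine sum_eq_zero fun i _ => ?_
    rw [Submodule.mem_orthogonal_singleton_iff_inner_right.1 (hle (hmem i)), zero_pow two_ne_zero]
  have hsupp : ∀ g : κ → ℝ, ∑ k, g k * ∑ i, inner ℝ (u k) (f i) ^ 2 =
      ∑ k ∈ K, g k * ∑ i, inner ℝ (u k) (f i) ^ 2 := fun g =>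
    (sum_subset (subset_univ K) fun k _ hk => by rw [hnotMem k hk, mul_zero]).symm
  have hone : ∀ k ∈ K, 1 - ∑ i, inner ℝ (u k) (f i) ^ 2 = 0 := by
    rw [← sum_eq_zero_iff_of_nonneg fun k _ => sub_nonneg.2 (sum_inner_sq_le_one hf u k)]
    have hsum := hsupp 1
    simp only [Pi.one_apply, one_mul] at hsum
    rw [sum_sub_distrib, ← hsum, sum_sum_inner_sq hf u, sum_const, hK]
    simp
  rw [sum_inner_map_self hT, hsupp]
  exact sum_congr rfl fun k hk => by rw [← sub_eq_zero.1 (hone k hk), mul_one]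

end TopEigenvectors

section Matrix

variable {N : ℕ} {A : Matrix (Fin N) (Fin N) ℝ} {W : Submodule ℝ (EuclideanSpace ℝ (Fin N))}

lemma inner_toEuclideanLin (A : Matrix (Fin N) (Fin N) ℝ) (x : EuclideanSpace ℝ (Fin N)) :
    inner ℝ x (Matrix.toEuclideanLin A x) = quadForm A x := by
  simp only [PiLp.inner_apply, quadForm, Matrix.toLpLin_apply, Matrix.mulVec, dotProduct]
  refine sum_congr rfl fun i _ => ?_
  simp only [RCLike.inner_apply, conj_trivial, sum_mul]
  exact sum_congr rfl fun j _ => by ring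

lemma card_filter_val_lt_two (hN : 2 ≤ N) : #{k : Fin N | (k : ℕ) < 2} = 2 := by
  rw [Fin.card_filter_val_lt, min_eq_right hN]

lemma IsTopTwoEigenspace.finrank_eq (hW : IsTopTwoEigenspace A W) (hN : 2 ≤ N) :
    Module.finrank ℝ W = 2 := by
  obtain ⟨lam, u, -, -, rfl⟩ := hW
  have hind : LinearIndependent ℝ fun k : {k : Fin N // (k : ℕ) < 2} => u k :=
    u.orthonormal.linearIndependent.comp _ Subtype.val_injective
  rw [Set.image_eq_range]
  exact (finrank_span_eq_card hind).trans
    ((Fintype.card_subtype _).trans (card_filter_val_lt_two hN))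

/-- The companion `w` of `v` completes it to an orthonormal basis of `W`. -/
lemma IsTopTwoEigenspace.exists_companion (hW : IsTopTwoEigenspace A W) (hN : 2 ≤ N)
    {v : EuclideanSpace ℝ (Fin N)} (hv : v ∈ W) (hv1 : ‖v‖ = 1) :
    ∃ w : EuclideanSpace ℝ (Fin N), ‖w‖ = 1 ∧ ∀ f g : EuclideanSpace ℝ (Fin N),
      ‖f‖ = 1 → ‖g‖ = 1 → inner ℝ f g = 0 →
        quadForm A f + quadForm A g ≤ quadForm A w + quadForm A v := by
  obtain ⟨w, hw, hw1, hvw⟩ := exists_unit_mem_inner_eq_zero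
    (one_lt_two.trans_eq (hW.finrank_eq hN).symm) v
  obtain ⟨lam, u, hlam, hT, rfl⟩ := hW
  refine ⟨w, hw1, fun f g hf hg hfg => ?_⟩
  have horth : ∀ {x y : EuclideanSpace ℝ (Fin N)}, ‖x‖ = 1 → ‖y‖ = 1 → inner ℝ x y = 0 →
      Orthonormal ℝ ![x, y] := fun hx hy hxy => by
    simp [orthonormal_vecCons_iff, hx, hy, hxy]
  have hcard : #{k : Fin N | (k : ℕ) < 2} = Fintype.card (Fin 2) := by
    rw [card_filter_val_lt_two hN, Fintype.card_fin]
  have hle := sum_inner_map_self_le (t := lam ⟨1, hN⟩) hT (horth hf hg hfg) hcard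
    (fun k hk => hlam (Fin.le_def.2 (Nat.le_of_lt_succ (mem_filter.1 hk).2)))
    fun k hk => hlam (Fin.le_def.2 (by simp at hk ⊢; omega))
  have heq := sum_inner_map_self_eq hT (horth hw1 hv1 (by rwa [real_inner_comm])) hcard
    (by simp only [coe_filter_univ]; exact Fin.forall_fin_two.2 ⟨hw, hv⟩)
  simp only [Fin.sum_univ_two, inner_toEuclideanLin, Matrix.cons_val_zero,
    Matrix.cons_val_one] at hle heq
  exact hle.trans_eq heq.symm

lemma exists_isTopTwoEigenspace (hA : A.IsHermitian) : ∃ W, IsTopTwoEigenspace A W := by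
  have hT := Matrix.isSymmetric_toEuclideanLin_iff.2 hA
  have hn : Module.finrank ℝ (EuclideanSpace ℝ (Fin N)) = N := finrank_euclideanSpace_fin
  exact ⟨_, hT.eigenvalues hn, hT.eigenvectorBasis hn, hT.eigenvalues_antitone hn,
    hT.apply_eigenvectorBasis hn, rfl⟩

lemma isHermitian_zeroOut (hA : A.IsHermitian) (d : ℝ) : (zeroOut A d).IsHermitian := by
  ext i j
  have hij : A j i = A i j := by simpa using hA.apply i j
  simp only [zeroOut, Matrix.conjTranspose_apply, Matrix.of_apply, star_trivial, hij, or_comm]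

lemma exists_isSpectralPartitionOutput {n : ℕ} (hn : 1 ≤ n)
    {A₀ : Matrix (Fin (2 * n)) (Fin (2 * n)) ℝ} (hA : A₀.IsHermitian) (d : ℝ) :
    ∃ S T, IsSpectralPartitionOutput n A₀ d S T := by
  obtain ⟨W, hW⟩ := exists_isTopTwoEigenspace (isHermitian_zeroOut hA d)
  obtain ⟨v₂, hv₂⟩ := exists_unit_mem_inner_eq_zero
    (one_lt_two.trans_eq (hW.finrank_eq (by omega)).symm)
    (W.starProjection (WithLp.toLp 2 fun _ => 1))
  refine ⟨_, _, W, _, v₂, Tuple.sort fun k => -v₂ k, hW, rfl, hv₂, fun k l hkl => ?_, rfl, rfl⟩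
  exact neg_le_neg_iff.1 (Tuple.monotone_sort (fun k => -v₂ k) hkl)

end Matrix

/-! ### Estimates for the block model -/

section Degrees

variable {V : Type*} [Fintype V]

lemma sum_sq_indicator_le (L : Set V) (x : V → ℝ) :
    ∑ u, L.indicator x u ^ 2 ≤ ∑ u, x u ^ 2 :=
  sum_le_sum fun u _ => by by_cases hu : u ∈ L <;> simp [hu, sq_nonneg]

lemma two_mul_sum_sum_eq_quadForm {M : Matrix V V ℝ} (hM : ∀ u v, M u v = M v u) (x : V → ℝ) :
    2 * ∑ u, x u * ∑ v, M u v = quadForm M x + quadForm M 1 - quadForm M (1 - x) := by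
  have hswap : ∑ u, x u * ∑ v, M u v = ∑ u, ∑ v, x v * M u v := by
    simp only [mul_sum]
    rw [sum_comm]
    exact sum_congr rfl fun u _ => sum_congr rfl fun v _ => by rw [hM]
  rw [two_mul]
  nth_rw 2 [hswap]
  simp only [quadForm, mul_sum, ← sum_add_distrib, ← sum_sub_distrib, Pi.sub_apply, Pi.one_apply]
  exact sum_congr rfl fun u _ => sum_congr rfl fun v _ => by ring

variable [DecidableEq V] {d : ℝ} {p : Sym2 V → unitInterval} {ω : Sym2 V → Prop}

lemma IsRegular.abs_quadForm_int_le (hω : IsRegular d p ω) (hd : 1 ≤ d) {z : V → ℤ}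
    (hz : ∀ u, |z u| ≤ 1) :
    |quadForm (noise p ω) fun u => (z u : ℝ)| ≤ 40 * √d * Fintype.card V := by
  rw [← lightPart_eq_quadForm fun u v => ?_]
  · exact hω.light _ (int_mem_latticeNet hz)
  · have hprod : |(z u : ℝ) * z v| ≤ 1 := by
      exact_mod_cast (abs_mul (z u) (z v)).trans_le
        (mul_le_one₀ (hz u) (abs_nonneg _) (hz v))
    exact hprod.trans (Real.one_le_sqrt.2 hd)

lemma IsRegular.sum_noise_le (hω : IsRegular d p ω) (hd : 1 ≤ d) (S : Finset V) :
    ∑ u ∈ S, ∑ v, noise p ω u v ≤ 60 * √d * Fintype.card V := by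
  set z : V → ℤ := fun u => if u ∈ S then 1 else 0
  have hz : ∀ u, |z u| ≤ 1 ∧ |1 - z u| ≤ 1 := fun u => by
    simp only [z]; split_ifs <;> simp
  have hS := hω.abs_quadForm_int_le hd fun u => (hz u).1
  have hcompl := hω.abs_quadForm_int_le hd fun u => (hz u).2
  have hone := hω.abs_quadForm_int_le hd (z := fun _ => 1) fun _ => by simp
  have hpolar := two_mul_sum_sum_eq_quadForm (noise_comm p ω) fun u => (z u : ℝ)
  have hsum : ∑ u, (z u : ℝ) * ∑ v, noise p ω u v = ∑ u ∈ S, ∑ v, noise p ω u v := by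
    simp [z]
  push_cast at hcompl hone
  rw [hsum] at hpolar
  change _ = _ + quadForm _ (fun _ => 1) - quadForm _ (fun u => 1 - (z u : ℝ)) at hpolar
  linarith [(abs_le.1 hS).2, (abs_le.1 hone).2, (abs_le.1 hcompl).1]

lemma IsRegular.mul_card_compl_lowDegree_le (hω : IsRegular d p ω) (hd : 1 ≤ d)
    (hp : ∀ u, ∑ v, meanMatrix p u v ≤ d) :
    d * #(lowDegree d ω)ᶜ ≤ 4 * √d * Fintype.card V := by
  have hdeg : #(lowDegree d ω)ᶜ * (19 * d) ≤ ∑ u ∈ (lowDegree d ω)ᶜ, ∑ v, noise p ω u v := by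
    rw [← nsmul_eq_mul]
    refine card_nsmul_le_sum _ _ _ fun u hu => ?_
    have hu' : 20 * d < ∑ v, edgeMatrix ω u v := by simpa [lowDegree] using hu
    simp only [noise, Matrix.sub_apply, sum_sub_distrib]
    linarith [hp u]
  have : 0 ≤ √d * Fintype.card V := by positivity
  linarith [hω.sum_noise_le hd (lowDegree d ω)ᶜ]

end Degrees

section Block

variable {V : Type*} [DecidableEq V]

/-- The vector that is `1` on the block `P` and `-1` on its complement. -/
def blockSign (P : Finset V) (u : V) : ℝ := if u ∈ P then 1 else -1

lemma blockSign_mul_self (P : Finset V) (u : V) : blockSign P u * blockSign P u = 1 := by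
  unfold blockSign; split_ifs <;> norm_num

lemma blockSign_compl [Fintype V] (P : Finset V) (u : V) : blockSign Pᶜ u = -blockSign P u := by
  by_cases hu : u ∈ P <;> simp [blockSign, hu]

lemma blockSign_mul_blockSign_le_one (P : Finset V) (u v : V) :
    blockSign P u * blockSign P v ≤ 1 := by
  unfold blockSign; split_ifs <;> norm_num

variable [Fintype V] {P : Finset V}

lemma sum_blockSign (hP : 2 * #P = Fintype.card V) : ∑ u, blockSign P u = 0 := by
  have hsign : ∀ u, blockSign P u = 2 * (if u ∈ P then 1 else 0) - 1 := fun u => by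
    unfold blockSign; split_ifs <;> norm_num
  simp only [hsign, sum_sub_distrib, ← mul_sum, sum_boole, filter_univ_mem, sum_const, card_univ,
    nsmul_eq_mul, mul_one]
  rw [← hP, Nat.cast_mul, Nat.cast_ofNat, sub_self]

/-- Bessel's inequality for the orthogonal vectors `1` and `blockSign P`. -/
lemma sq_sum_add_sq_sum_blockSign_le (hP : 2 * #P = Fintype.card V) (x : V → ℝ) :
    (∑ u, x u) ^ 2 + (∑ u, blockSign P u * x u) ^ 2 ≤ Fintype.card V * ∑ u, x u ^ 2 := by
  rcases isEmpty_or_nonempty V with _ | _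
  · simp
  set N : ℝ := (Fintype.card V : ℝ) with hN
  set s := ∑ u, x u
  set t := ∑ u, blockSign P u * x u
  have hdist : ∑ u, (N * x u - s - blockSign P u * t) ^ 2 =
      N * (N * ∑ u, x u ^ 2 - (s ^ 2 + t ^ 2)) := by
    have hterm : ∀ u, (N * x u - s - blockSign P u * t) ^ 2 = N ^ 2 * x u ^ 2 - 2 * N * s * x u -
        2 * N * t * (blockSign P u * x u) + (s ^ 2 + t ^ 2) + 2 * s * t * blockSign P u :=
      fun u => by linear_combination t ^ 2 * blockSign_mul_self P u
    simp only [hterm, sum_add_distrib, sum_sub_distrib, ← mul_sum, sum_blockSign hP, sum_const,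
      card_univ, nsmul_eq_mul, ← hN]
    ring
  have hnonneg := hdist ▸ sum_nonneg fun u _ => sq_nonneg (N * x u - s - blockSign P u * t)
  linarith [nonneg_of_mul_nonneg_right hnonneg (by positivity)]

/-- `card V` times the quadratic form of the expected adjacency matrix, with the diagonal entries
`2 * a / card V` included. -/
def blockForm (a b : ℝ) (P : Finset V) (x : V → ℝ) : ℝ :=
  (a + b) * (∑ u, x u) ^ 2 + (a - b) * (∑ u, blockSign P u * x u) ^ 2

lemma blockForm_le {a b : ℝ} (hb : 0 ≤ b) (hab : b ≤ a) (hP : 2 * #P = Fintype.card V)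
    (x : V → ℝ) : blockForm a b P x ≤ (a + b) * (Fintype.card V * ∑ u, x u ^ 2) :=
  calc blockForm a b P x
      ≤ (a + b) * (∑ u, x u) ^ 2 + (a + b) * (∑ u, blockSign P u * x u) ^ 2 := by
        unfold blockForm; gcongr; linarith
    _ = (a + b) * ((∑ u, x u) ^ 2 + (∑ u, blockSign P u * x u) ^ 2) := by ring
    _ ≤ (a + b) * (Fintype.card V * ∑ u, x u ^ 2) :=
        mul_le_mul_of_nonneg_left (sq_sum_add_sq_sum_blockSign_le hP x) (by linarith)

lemma blockForm_indicator_le {a b : ℝ} (hab : 0 ≤ a + b) (L : Finset V) {x : V → ℝ}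
    (hx0 : ∑ u, x u = 0) (hx : ∑ u, x u ^ 2 ≤ 1) :
    blockForm a b P ((L : Set V).indicator x) ≤ (a + b) * #Lᶜ +
      (a - b) * (∑ u, blockSign P u * (L : Set V).indicator x u) ^ 2 := by
  have hcompl : ∑ u, (L : Set V).indicator x u = -∑ u ∈ Lᶜ, x u := by
    rw [sum_indicator_subset x (subset_univ L)]
    linarith [sum_add_sum_compl L x]
  have hsq : (∑ u, (L : Set V).indicator x u) ^ 2 ≤ #Lᶜ :=
    calc (∑ u, (L : Set V).indicator x u) ^ 2 ≤ #Lᶜ * ∑ u ∈ Lᶜ, x u ^ 2 := by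
          rw [hcompl, neg_sq]; exact sq_sum_le_card_mul_sum_sq
      _ ≤ #Lᶜ := mul_le_of_le_one_right (Nat.cast_nonneg _)
          ((sum_le_univ_sum_of_nonneg fun _ => sq_nonneg _).trans hx)
  unfold blockForm
  gcongr

lemma le_blockForm_indicator_add {a b : ℝ} (hb : 0 ≤ b) (hab : b ≤ a) (L : Finset V) :
    2 * a * Fintype.card V ^ 2 - 4 * a * Fintype.card V * #Lᶜ ≤
      blockForm a b P ((L : Set V).indicator 1) +
        blockForm a b P ((L : Set V).indicator (blockSign P)) := by
  have hone : ∑ u, (L : Set V).indicator 1 u = (#L : ℝ) := by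
    rw [sum_indicator_subset 1 (subset_univ L)]; simp
  have hsign : ∑ u, blockSign P u * (L : Set V).indicator (blockSign P) u = (#L : ℝ) := by
    rw [← hone]
    refine sum_congr rfl fun u _ => ?_
    by_cases hu : u ∈ L <;> simp [hu, blockSign_mul_self]
  have hcard : (#L : ℝ) = Fintype.card V - #Lᶜ := by
    rw [← card_add_card_compl L]; push_cast; ring
  have hlow : 2 * a * (#L : ℝ) ^ 2 ≤ blockForm a b P ((L : Set V).indicator 1) +
      blockForm a b P ((L : Set V).indicator (blockSign P)) := by
    have h₁ := mul_nonneg (sub_nonneg.2 hab)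
      (sq_nonneg (∑ u, blockSign P u * (L : Set V).indicator 1 u))
    have h₂ := mul_nonneg (show 0 ≤ a + b by linarith)
      (sq_nonneg (∑ u, (L : Set V).indicator (blockSign P) u))
    unfold blockForm
    rw [hone, hsign]
    linarith
  refine le_trans ?_ hlow
  rw [hcard]
  linarith [mul_nonneg (hb.trans hab) (sq_nonneg (#Lᶜ : ℝ))]

/-- `p` is the family of edge probabilities of the block model with the blocks `P` and `Pᶜ`, written
with `blockSign`: it is `2 * a / card V` inside the blocks and `2 * b / card V` between them. -/
def IsBlockProb (a b : ℝ) (P : Finset V) (p : Sym2 V → unitInterval) : Prop :=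
  ∀ u v, (p s(u, v) : ℝ) = (a + b + (a - b) * (blockSign P u * blockSign P v)) / Fintype.card V

variable {a b : ℝ} {p : Sym2 V → unitInterval} {ω : Sym2 V → Prop}

lemma IsBlockProb.le (hp : IsBlockProb a b P p) (hb : 0 ≤ b) (hab : b ≤ a) (e : Sym2 V) :
    (p e : ℝ) ≤ 2 * (a + b) / Fintype.card V := by
  induction e using Sym2.ind with
  | _ u v =>
    rw [hp u v]
    gcongr
    linarith [mul_le_of_le_one_right (sub_nonneg.2 hab) (blockSign_mul_blockSign_le_one P u v)]

lemma IsBlockProb.sum_meanMatrix_le [Nonempty V] (hp : IsBlockProb a b P p)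
    (hP : 2 * #P = Fintype.card V) (u : V) : ∑ v, meanMatrix p u v ≤ a + b := by
  calc ∑ v, meanMatrix p u v ≤ ∑ v, (p s(u, v) : ℝ) := by
        refine sum_le_sum fun v _ => ?_
        simp only [meanMatrix, Matrix.of_apply]
        split_ifs
        exacts [(p _).2.1, le_rfl]
    _ = a + b := by
        simp only [hp u, ← sum_div, sum_add_distrib, ← mul_sum, sum_blockSign hP, sum_const,
          card_univ, nsmul_eq_mul, mul_zero, add_zero]
        field_simp

lemma IsBlockProb.quadForm_meanMatrix (hp : IsBlockProb a b P p) (x : V → ℝ) :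
    quadForm (meanMatrix p) x = (blockForm a b P x - 2 * a * ∑ u, x u ^ 2) / Fintype.card V := by
  set N : ℝ := (Fintype.card V : ℝ)
  have hterm : ∀ u v, x u * x v * meanMatrix p u v =
      ((a + b) * (x u * x v) + (a - b) * (blockSign P u * x u * (blockSign P v * x v)) -
        if u = v then 2 * a * x u ^ 2 else 0) / N := fun u v => by
    simp only [meanMatrix, Matrix.of_apply]
    split_ifs with huv
    · subst huv
      linear_combination (-(a - b) * x u ^ 2 / N) * blockSign_mul_self P u
    · rw [hp u v]; ring
  simp only [quadForm, hterm, ← sum_div, sum_sub_distrib, sum_add_distrib, ← mul_sum,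
    sum_ite_eq, mem_univ, if_true, blockForm, sq (∑ _, _), sum_mul_sum]

/-- The matrix to which the algorithm applies the eigenvector computation: the adjacency matrix with
the rows and columns of the vertices of degree more than `20 * d` zeroed out. -/
def trimmedMatrix (d : ℝ) (ω : Sym2 V → Prop) : Matrix V V ℝ :=
  restrict (lowDegree d ω) (edgeMatrix ω)

lemma IsRegular.abs_quadForm_trimmedMatrix_sub_le [Nonempty V]
    (hω : IsRegular (a + b) p ω) (hp : IsBlockProb a b P p) (hb : 0 ≤ b) (hab : b < a)
    (hcard : √(a + b) ≤ Fintype.card V) (x : V → ℝ) :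
    |quadForm (trimmedMatrix (a + b) ω) x -
        blockForm a b P ((lowDegree (a + b) ω : Set V).indicator x) / Fintype.card V| ≤
      54248 * √(a + b) * ∑ u, x u ^ 2 := by
  set y := (lowDegree (a + b) ω : Set V).indicator x
  have hnoise := hω.abs_quadForm_restrict_noise_le (by linarith) (hp.le hb hab.le) x
  have hsplit : quadForm (noise p ω) y = quadForm (edgeMatrix ω) y - quadForm (meanMatrix p) y := by
    simp only [quadForm, noise, Matrix.sub_apply, mul_sub, sum_sub_distrib]
  rw [quadForm_restrict, hsplit, hp.quadForm_meanMatrix, sub_div] at hnoise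
  rw [trimmedMatrix, quadForm_restrict]
  have hdiag : 2 * a * (∑ u, y u ^ 2) / Fintype.card V ≤ 2 * √(a + b) * ∑ u, x u ^ 2 := by
    rw [div_le_iff₀ (by positivity), mul_right_comm _ (∑ _, _)]
    refine mul_le_mul ?_ (sum_sq_indicator_le _ x) (sum_nonneg fun _ _ => sq_nonneg _)
      (by positivity)
    calc 2 * a ≤ 2 * (√(a + b) * √(a + b)) := by
          rw [Real.mul_self_sqrt (by linarith)]; linarith
      _ ≤ 2 * √(a + b) * Fintype.card V := by rw [mul_assoc]; gcongr
  have hdiag0 : 0 ≤ 2 * a * (∑ u, y u ^ 2) / Fintype.card V := by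
    have : 0 ≤ a := hb.trans hab.le
    positivity
  rw [abs_le] at hnoise ⊢
  constructor <;> linarith

lemma IsRegular.le_quadForm_one_add_quadForm_blockSign [Nonempty V]
    (hω : IsRegular (a + b) p ω) (hd : 1 ≤ a + b) (hp : IsBlockProb a b P p) (hb : 0 ≤ b)
    (hab : b < a) (hP : 2 * #P = Fintype.card V) (hcard : √(a + b) ≤ Fintype.card V) :
    (2 * a - 108512 * √(a + b)) * Fintype.card V ≤
      quadForm (trimmedMatrix (a + b) ω) 1 + quadForm (trimmedMatrix (a + b) ω) (blockSign P) := by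
  set N : ℝ := (Fintype.card V : ℝ) with hN
  have hN0 : 0 < N := by positivity
  have hone := (abs_le.1 (hω.abs_quadForm_trimmedMatrix_sub_le hp hb hab hcard 1)).1
  have hsign :=
    (abs_le.1 (hω.abs_quadForm_trimmedMatrix_sub_le hp hb hab hcard (blockSign P))).1
  have hnorm : ∑ u, (1 : V → ℝ) u ^ 2 = N ∧ ∑ u, blockSign P u ^ 2 = N := by
    simp [sq, blockSign_mul_self, hN]
  rw [hnorm.1] at hone
  rw [hnorm.2] at hsign
  have hlow : (2 * a - 16 * √(a + b)) * N ≤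
      blockForm a b P ((lowDegree (a + b) ω : Set V).indicator 1) / N +
        blockForm a b P ((lowDegree (a + b) ω : Set V).indicator (blockSign P)) / N := by
    have hhigh : a * #(lowDegree (a + b) ω)ᶜ ≤ 4 * √(a + b) * N :=
      (mul_le_mul_of_nonneg_right (by linarith) (Nat.cast_nonneg _)).trans
        (hω.mul_card_compl_lowDegree_le hd (hp.sum_meanMatrix_le hP))
    rw [← add_div, le_div_iff₀ hN0]
    refine le_trans ?_ (le_blockForm_indicator_add hb hab.le (lowDegree (a + b) ω))
    linarith [mul_le_mul_of_nonneg_right hhigh hN0.le]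
  linarith

lemma IsRegular.correlation_le [Nonempty V]
    (hω : IsRegular (a + b) p ω) (hd : 1 ≤ a + b) (hp : IsBlockProb a b P p) (hb : 0 ≤ b)
    (hab : b < a) (hP : 2 * #P = Fintype.card V) (hcard : √(a + b) ≤ Fintype.card V)
    {w v : V → ℝ} (hw : ∑ u, w u ^ 2 = 1) (hv : ∑ u, v u ^ 2 = 1) (hv0 : ∑ u, v u = 0)
    (hmax : (quadForm (trimmedMatrix (a + b) ω) 1 +
        quadForm (trimmedMatrix (a + b) ω) (blockSign P)) / Fintype.card V ≤
      quadForm (trimmedMatrix (a + b) ω) w + quadForm (trimmedMatrix (a + b) ω) v) :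
    (a - b) * (1 - (∑ u, blockSign P u * (lowDegree (a + b) ω : Set V).indicator v u) ^ 2 /
      Fintype.card V) ≤ 217012 * √(a + b) := by
  set N : ℝ := (Fintype.card V : ℝ)
  have hN0 : 0 < N := by positivity
  have hlow := hω.le_quadForm_one_add_quadForm_blockSign hd hp hb hab hP hcard
  rw [← le_div_iff₀ hN0] at hlow
  have hw' := (abs_le.1 (hω.abs_quadForm_trimmedMatrix_sub_le hp hb hab hcard w)).2
  have hv' := (abs_le.1 (hω.abs_quadForm_trimmedMatrix_sub_le hp hb hab hcard v)).2
  have hwform : blockForm a b P ((lowDegree (a + b) ω : Set V).indicator w) / N ≤ a + b := by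
    rw [div_le_iff₀ hN0]
    refine (blockForm_le hb hab.le hP _).trans (mul_le_mul_of_nonneg_left ?_ (by linarith))
    exact mul_le_of_le_one_right hN0.le ((sum_sq_indicator_le _ w).trans_eq hw)
  have hvform : blockForm a b P ((lowDegree (a + b) ω : Set V).indicator v) / N ≤
      4 * √(a + b) + (a - b) *
        ((∑ u, blockSign P u * (lowDegree (a + b) ω : Set V).indicator v u) ^ 2 / N) := by
    rw [div_le_iff₀ hN0, add_mul, mul_assoc (a - b), div_mul_cancel₀ _ hN0.ne']
    refine (blockForm_indicator_le (by linarith) _ hv0 hv.le).trans (add_le_add_left ?_ _)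
    exact hω.mul_card_compl_lowDegree_le hd (hp.sum_meanMatrix_le hP)
  rw [hw] at hw'
  rw [hv] at hv'
  linarith

end Block

/-! ### From correlation to partition -/

section Rounding

variable {V : Type*} [DecidableEq V] [Fintype V] {P S H R : Finset V} {x y : V → ℝ} {η : ℝ}

lemma card_le_of_blockSign_mul_nonpos [Nonempty V] (hy : ∑ u, y u ^ 2 ≤ 1)
    (hxy : ∀ u ∉ H, y u = x u) (hc : 0 < ∑ u, blockSign P u * y u) (hη : η ≤ 1 / 2)
    (hcorr : 1 - η ≤ (∑ u, blockSign P u * y u) ^ 2 / Fintype.card V)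
    (hR : ∀ u ∈ R, blockSign P u * x u ≤ 0) : (#R : ℝ) ≤ #H + 2 * η * Fintype.card V := by
  set N : ℝ := (Fintype.card V : ℝ) with hN
  have hN0 : 0 < N := by positivity
  set c := ∑ u, blockSign P u * y u with hcdef
  rw [le_div_iff₀ hN0] at hcorr
  have hdist : ∑ u, (N * y u - c * blockSign P u) ^ 2 ≤ N * (N * η) := by
    have hterm : ∀ u, (N * y u - c * blockSign P u) ^ 2 =
        N ^ 2 * y u ^ 2 - 2 * N * c * (blockSign P u * y u) + c ^ 2 := fun u => by
      linear_combination c ^ 2 * blockSign_mul_self P u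
    simp only [hterm, sum_add_distrib, sum_sub_distrib, ← mul_sum, ← hcdef, sum_const, card_univ,
      nsmul_eq_mul, ← hN]
    linarith [mul_le_mul_of_nonneg_left hy (sq_nonneg N), mul_le_mul_of_nonneg_left hcorr hN0.le]
  have hmarkov : #(R \ H) * c ^ 2 ≤ N * (N * η) := by
    rw [← nsmul_eq_mul]
    refine (card_nsmul_le_sum _ _ _ fun u hu => ?_).trans
      ((sum_le_univ_sum_of_nonneg fun _ => sq_nonneg _).trans hdist)
    obtain ⟨huR, huH⟩ := mem_sdiff.1 hu
    rw [hxy u huH]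
    have := mul_nonneg (mul_pos hN0 hc).le (neg_nonneg.2 (hR u huR))
    linarith [sq_nonneg (N * x u), congr_arg (c ^ 2 * ·) (blockSign_mul_self P u)]
  have hsdiff : (#(R \ H) : ℝ) ≤ 2 * η * N := by
    refine le_of_mul_le_mul_left ?_ (half_pos hN0)
    calc N / 2 * #(R \ H) ≤ c ^ 2 * #(R \ H) := by gcongr; nlinarith
      _ ≤ N / 2 * (2 * η * N) := by linarith
  have hcard : (#R : ℝ) ≤ #H + #(R \ H) := by
    exact_mod_cast (card_le_card_sdiff_add_card (s := R) (t := H)).trans_eq (add_comm _ _)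
  linarith

lemma card_sdiff_le_of_correlation [Nonempty V] (hPS : #P = #S)
    (hxS : ∀ u ∈ S, ∀ v ∉ S, x v ≤ x u) (hy : ∑ u, y u ^ 2 ≤ 1)
    (hxy : ∀ u ∉ H, y u = x u) (hc : 0 < ∑ u, blockSign P u * y u) (hη : η ≤ 1 / 2)
    (hcorr : 1 - η ≤ (∑ u, blockSign P u * y u) ^ 2 / Fintype.card V) :
    (#(P \ S) : ℝ) ≤ #H + 2 * η * Fintype.card V := by
  by_cases hneg : ∀ v ∉ S, x v ≤ 0
  · refine card_le_of_blockSign_mul_nonpos hy hxy hc hη hcorr fun u hu => ?_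
    obtain ⟨huP, huS⟩ := mem_sdiff.1 hu
    rw [blockSign, if_pos huP, one_mul]
    exact hneg u huS
  · push Not at hneg
    obtain ⟨v, hvS, hv⟩ := hneg
    rw [card_sdiff_comm hPS]
    refine card_le_of_blockSign_mul_nonpos hy hxy hc hη hcorr fun u hu => ?_
    obtain ⟨huS, huP⟩ := mem_sdiff.1 hu
    rw [blockSign, if_neg huP, neg_one_mul, neg_nonpos]
    exact hv.le.trans (hxS u huS v hvS)

end Rounding

/-! ### The algorithm on a regular graph -/

section Algorithm

variable {n : ℕ} {a b γ : ℝ} {P S : Finset (Fin (2 * n))} {p : Sym2 (Fin (2 * n)) → unitInterval}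
  {ω : Sym2 (Fin (2 * n)) → Prop}

lemma adjacency_graphOf (ω : Sym2 (Fin (2 * n)) → Prop) : adjacency (graphOf ω) = edgeMatrix ω := by
  ext u v
  rw [adjacency, SimpleGraph.adjMatrix_apply]
  by_cases huv : u = v <;> by_cases hω : ω s(u, v) <;>
    simp [graphOf, SimpleGraph.fromEdgeSet_adj, edgeMatrix, truth, huv, hω]

lemma zeroOut_adjacency_graphOf (d : ℝ) (ω : Sym2 (Fin (2 * n)) → Prop) :
    zeroOut (adjacency (graphOf ω)) d = trimmedMatrix d ω := by
  ext u v
  by_cases hu : 20 * d < ∑ k, edgeMatrix ω u k <;> by_cases hv : 20 * d < ∑ k, edgeMatrix ω v k <;>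
    simp [zeroOut, adjacency_graphOf, trimmedMatrix, restrict, lowDegree, ← not_lt, hu, hv]

lemma isHermitian_adjacency (G : SimpleGraph (Fin (2 * n))) : (adjacency G).IsHermitian := by
  rw [Matrix.IsHermitian, Matrix.conjTranspose_eq_transpose_of_trivial, adjacency,
    SimpleGraph.transpose_adjMatrix]

lemma coe_prob_div {x : ℝ} (hx : 0 ≤ x) (hxn : x ≤ n) : (prob (x / n) : ℝ) = x / n := by
  rw [prob, Set.projIcc_of_mem zero_le_one ⟨by positivity, div_le_one_of_le₀ hxn n.cast_nonneg⟩]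

lemma isBlockProb_edgeProb (hb : 0 ≤ b) (hab : b ≤ a) (han : a ≤ n) (P : Finset (Fin (2 * n))) :
    IsBlockProb a b P (edgeProb n a b P) := by
  intro u v
  have hprob : (edgeProb n a b P s(u, v) : ℝ) = if (u ∈ P ↔ v ∈ P) then a / n else b / n := by
    rw [← coe_prob_div (hb.trans hab) han, ← coe_prob_div hb (hab.trans han), edgeProb]
    simp only [Sym2.mem_iff, forall_eq_or_imp, forall_eq]
    by_cases hu : u ∈ P <;> by_cases hv : v ∈ P <;> simp [hu, hv]
  rw [hprob, Fintype.card_fin, Nat.cast_mul, Nat.cast_ofNat]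
  by_cases hu : u ∈ P <;> by_cases hv : v ∈ P <;> simp [blockSign, hu, hv] <;> ring

/-- The first half of the vertices in the order `τ`. -/
def firstHalf (τ : Equiv.Perm (Fin (2 * n))) : Finset (Fin (2 * n)) :=
  (univ.filter fun k : Fin (2 * n) => (k : ℕ) < n).image τ

lemma card_firstHalf (τ : Equiv.Perm (Fin (2 * n))) : #(firstHalf τ) = n := by
  rw [firstHalf, card_image_of_injective _ τ.injective, Fin.card_filter_val_lt]
  omega

lemma mem_firstHalf {τ : Equiv.Perm (Fin (2 * n))} {k : Fin (2 * n)} :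
    τ k ∈ firstHalf τ ↔ (k : ℕ) < n := by
  simp [firstHalf]

lemma le_of_mem_firstHalf_of_notMem {x : Fin (2 * n) → ℝ} {τ : Equiv.Perm (Fin (2 * n))}
    (hτ : ∀ k l, k ≤ l → x (τ l) ≤ x (τ k)) {u v : Fin (2 * n)} (hu : u ∈ firstHalf τ)
    (hv : v ∉ firstHalf τ) : x v ≤ x u := by
  obtain ⟨k, rfl⟩ := τ.surjective u
  obtain ⟨l, rfl⟩ := τ.surjective v
  rw [mem_firstHalf] at hu hv
  exact hτ k l (Fin.le_def.2 (by omega))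

lemma IsRegular.eigenvector_correlation_le (hn : 1 ≤ n) (hω : IsRegular (a + b) p ω)
    (hd : 1 ≤ a + b) (hp : IsBlockProb a b P p) (hb : 0 ≤ b) (hab : b < a) (han : a ≤ n)
    (hP : #P = n) {W : Submodule ℝ (EuclideanSpace ℝ (Fin (2 * n)))}
    (hW : IsTopTwoEigenspace (trimmedMatrix (a + b) ω) W)
    {v : EuclideanSpace ℝ (Fin (2 * n))} (hvW : v ∈ W) (hv1 : ‖v‖ = 1)
    (hv : inner ℝ (W.starProjection (WithLp.toLp 2 fun _ => 1)) v = 0) :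
    (a - b) * (1 -
      (∑ u, blockSign P u * (lowDegree (a + b) ω : Set (Fin (2 * n))).indicator v u) ^ 2 /
        Fintype.card (Fin (2 * n))) ≤ 217012 * √(a + b) := by
  have : Nonempty (Fin (2 * n)) := ⟨⟨0, by omega⟩⟩
  have hP2 : 2 * #P = Fintype.card (Fin (2 * n)) := by rw [hP, Fintype.card_fin]
  have hcard : √(a + b) ≤ Fintype.card (Fin (2 * n)) := by
    rw [Fintype.card_fin, Nat.cast_mul, Nat.cast_ofNat]
    exact (Real.sqrt_le_self_iff.2 (Or.inr hd)).trans (by linarith)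
  obtain ⟨w, hw1, hw⟩ := hW.exists_companion (by omega) hvW hv1
  have hsq : ∀ x : EuclideanSpace ℝ (Fin (2 * n)), ‖x‖ = 1 → ∑ u, x u ^ 2 = 1 := fun x hx => by
    rw [← EuclideanSpace.real_norm_sq_eq, hx, one_pow]
  have hv0 : ∑ u, v u = 0 := by
    rw [Submodule.inner_starProjection_left_eq_right,
      Submodule.starProjection_eq_self_iff.2 hvW] at hv
    simpa [PiLp.inner_apply] using hv
  refine hω.correlation_le hd hp hb hab hP2 hcard (hsq w hw1) (hsq v hv1) hv0 ?_
  set N : ℝ := (Fintype.card (Fin (2 * n)) : ℝ) with hN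
  have hN0 : 0 < N := by positivity
  have hunit : ∀ x : Fin (2 * n) → ℝ, (∀ u, x u * x u = 1) →
      ‖(√N)⁻¹ • WithLp.toLp 2 x‖ = 1 := fun x hx => by
    have hx' : ‖WithLp.toLp 2 x‖ = √N := by simp [EuclideanSpace.norm_eq, sq, hx, hN]
    rw [norm_smul, norm_inv, hx', Real.norm_of_nonneg (Real.sqrt_nonneg N),
      inv_mul_cancel₀ (Real.sqrt_pos.2 hN0).ne']
  have hmax := hw ((√N)⁻¹ • WithLp.toLp 2 1) ((√N)⁻¹ • WithLp.toLp 2 (blockSign P))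
    (hunit 1 fun _ => one_mul 1) (hunit _ (blockSign_mul_self P))
    (by simp [inner_smul_left, inner_smul_right, PiLp.inner_apply, sum_blockSign hP2])
  rw [add_div, div_eq_inv_mul, div_eq_inv_mul]
  simpa only [WithLp.ofLp_smul, quadForm_smul, inv_pow, Real.sq_sqrt hN0.le] using hmax

lemma IsCorrect.swap {V₁ V₂ S T : Finset (Fin (2 * n))} (h : IsCorrect n γ V₁ V₂ S T) :
    IsCorrect n γ V₂ V₁ S T := h.symm.imp And.symm And.symm

lemma isCorrect_compl_of_card_sdiff_le (hP : #P = n) (hS : #S = n) (h : (#(P \ S) : ℝ) ≤ γ * n) :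
    IsCorrect n γ P Pᶜ S Sᶜ := by
  have hinter : (#(P ∩ S) : ℝ) = n - #(P \ S) := by
    rw [eq_sub_iff_add_eq', ← Nat.cast_add, card_sdiff_add_card_inter, hP]
  have hcompl : #(Pᶜ ∩ Sᶜ) = #(P ∩ S) := by
    have hsum := card_union_add_card_inter P S
    have hle := card_le_univ (P ∪ S)
    rw [Fintype.card_fin] at hle
    rw [← compl_union, card_compl, Fintype.card_fin]
    omega
  left
  rw [hcompl, hinter]
  constructor <;> linarith

lemma isCorrect_of_correlation {H : Finset (Fin (2 * n))} {x y : Fin (2 * n) → ℝ} (hn : 1 ≤ n)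
    (hγ : γ ≤ 1) (hP : #P = n) (hS : #S = n) (hxS : ∀ u ∈ S, ∀ v ∉ S, x v ≤ x u)
    (hy : ∑ u, y u ^ 2 ≤ 1) (hxy : ∀ u ∉ H, y u = x u) (hH : (#H : ℝ) ≤ γ * n / 2)
    (hcorr : 1 - γ / 8 ≤ (∑ u, blockSign P u * y u) ^ 2 / Fintype.card (Fin (2 * n))) :
    IsCorrect n γ P Pᶜ S Sᶜ := by
  have : Nonempty (Fin (2 * n)) := ⟨⟨0, by omega⟩⟩
  have hpos : ∀ Q : Finset (Fin (2 * n)), #Q = n → 0 < ∑ u, blockSign Q u * y u →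
      1 - γ / 8 ≤ (∑ u, blockSign Q u * y u) ^ 2 / Fintype.card (Fin (2 * n)) →
      IsCorrect n γ Q Qᶜ S Sᶜ := fun Q hQ hc hcorr => by
    refine isCorrect_compl_of_card_sdiff_le hQ hS ?_
    have h := card_sdiff_le_of_correlation (hQ.trans hS.symm) hxS hy hxy hc (by linarith) hcorr
    rw [Fintype.card_fin, Nat.cast_mul, Nat.cast_ofNat] at h
    linarith
  have hcompl : ∑ u, blockSign Pᶜ u * y u = -∑ u, blockSign P u * y u := by
    simp only [blockSign_compl, neg_mul, sum_neg_distrib]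
  rcases lt_trichotomy (∑ u, blockSign P u * y u) 0 with hneg | hzero | hc
  · have h := hpos Pᶜ (by rw [card_compl, Fintype.card_fin, hP]; omega) (by linarith)
      (by rwa [hcompl, neg_sq])
    rw [compl_compl] at h
    exact h.swap
  · rw [hzero, zero_pow two_ne_zero, zero_div] at hcorr
    linarith
  · exact hpos P hP hc hcorr

lemma mul_sqrt_le_of_separation (hd : 0 < a + b) (hab : b ≤ a) (hγ : 0 < γ)
    (hsep : 4 * 10 ^ 12 * (1 / γ ^ 2) ≤ (a - b) ^ 2 / (a + b)) :
    2 * 10 ^ 6 * √(a + b) ≤ γ * (a - b) := by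
  rw [mul_one_div, div_le_div_iff₀ (by positivity) hd] at hsep
  refine le_of_sq_le_sq ?_ (mul_nonneg hγ.le (sub_nonneg.2 hab))
  rw [mul_pow, Real.sq_sqrt hd.le]
  linarith

lemma le_mul_sqrt_of_separation (hb : 0 ≤ b) (hab : b < a) (hγ : 0 < γ)
    (hsep : 4 * 10 ^ 12 * (1 / γ ^ 2) ≤ (a - b) ^ 2 / (a + b)) :
    2 * 10 ^ 6 ≤ γ * √(a + b) := by
  have hd : 0 < a + b := by linarith
  refine le_of_mul_le_mul_right ?_ (Real.sqrt_pos.2 hd)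
  calc 2 * 10 ^ 6 * √(a + b) ≤ γ * (a - b) := mul_sqrt_le_of_separation hd hab.le hγ hsep
    _ ≤ γ * (a + b) := by gcongr; linarith
    _ = γ * √(a + b) * √(a + b) := by rw [mul_assoc, Real.mul_self_sqrt hd.le]

lemma IsRegular.card_compl_lowDegree_le (hω : IsRegular (a + b) p ω) (hp : IsBlockProb a b P p)
    (hd : 1 ≤ a + b) (hP : #P = n) (hγ : 2 * 10 ^ 6 ≤ γ * √(a + b)) :
    (#(lowDegree (a + b) ω)ᶜ : ℝ) ≤ γ * n / 2 := by
  have hP2 : 2 * #P = Fintype.card (Fin (2 * n)) := by rw [hP, Fintype.card_fin]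
  have hhigh := hω.mul_card_compl_lowDegree_le hd fun u =>
    haveI : Nonempty (Fin (2 * n)) := ⟨u⟩; hp.sum_meanMatrix_le hP2 u
  rw [Fintype.card_fin, Nat.cast_mul, Nat.cast_ofNat] at hhigh
  refine le_of_mul_le_mul_left ?_ (zero_lt_one.trans_le hd)
  calc (a + b) * #(lowDegree (a + b) ω)ᶜ ≤ 4 * √(a + b) * (2 * n) := hhigh
    _ ≤ γ * √(a + b) / 2 * √(a + b) * n := by
      have h : 0 ≤ √(a + b) * n := by positivity
      nlinarith
    _ = γ * (√(a + b) * √(a + b)) * n / 2 := by ring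
    _ = (a + b) * (γ * n / 2) := by rw [Real.mul_self_sqrt (by linarith)]; ring

lemma isCorrect_of_one_le (hγ : 1 ≤ γ) (V₁ V₂ S T : Finset (Fin (2 * n))) :
    IsCorrect n γ V₁ V₂ S T := by
  have h : (1 - γ) * n ≤ 0 := mul_nonpos_of_nonpos_of_nonneg (by linarith) n.cast_nonneg
  exact Or.inl ⟨h.trans (Nat.cast_nonneg _), h.trans (Nat.cast_nonneg _)⟩

theorem IsRegular.isCorrect (hn : 1 ≤ n) (hω : IsRegular (a + b) p ω) (hp : IsBlockProb a b P p)
    (hb : 0 ≤ b) (hab : b < a) (hγ : 0 < γ)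
    (hsep : 4 * 10 ^ 12 * (1 / γ ^ 2) ≤ (a - b) ^ 2 / (a + b)) (han : a ≤ n) (hP : #P = n)
    {S T : Finset (Fin (2 * n))}
    (hout : IsSpectralPartitionOutput n (adjacency (graphOf ω)) (a + b) S T) :
    IsCorrect n γ P Pᶜ S T := by
  rcases le_or_gt 1 γ with hγ1 | hγ1
  · exact isCorrect_of_one_le hγ1 _ _ _ _
  obtain ⟨W, v₁, v, τ, hW, rfl, ⟨hvW, hv1, hv⟩, hτ, rfl, rfl⟩ := hout
  rw [zeroOut_adjacency_graphOf] at hW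
  have hγd := le_mul_sqrt_of_separation hb hab hγ hsep
  have hd : 1 ≤ a + b := Real.one_le_sqrt.1 (by nlinarith [Real.sqrt_nonneg (a + b)])
  have hcorr : 1 - γ / 8 ≤
      (∑ u, blockSign P u * (lowDegree (a + b) ω : Set (Fin (2 * n))).indicator v u) ^ 2 /
        Fintype.card (Fin (2 * n)) := by
    have h := hω.eigenvector_correlation_le hn hd hp hb hab han hP hW hvW hv1 hv
    have hsqrt := mul_sqrt_le_of_separation (by linarith) hab.le hγ hsep
    rw [sub_le_comm]
    refine le_of_mul_le_mul_left ?_ (sub_pos.2 hab)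
    linarith [Real.sqrt_nonneg (a + b)]
  refine isCorrect_of_correlation hn hγ1.le hP (card_firstHalf τ)
    (fun u hu v hv => le_of_mem_firstHalf_of_notMem hτ hu hv) ?_ (fun u hu => ?_)
    (hω.card_compl_lowDegree_le hp hd hP hγd) hcorr
  · have hv' : ∑ u, v u ^ 2 = 1 := by rw [← EuclideanSpace.real_norm_sq_eq, hv1, one_pow]
    exact (sum_sq_indicator_le _ _).trans_eq hv'
  · exact Set.indicator_of_mem (by simpa using hu) _

theorem le_measure_spectralPartitionSucceeds (hn : 1 ≤ n) (hb : 0 ≤ b) (hab : b < a) (hγ : 0 < γ)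
    (hsep : 4 * 10 ^ 12 * (1 / γ ^ 2) ≤ (a - b) ^ 2 / (a + b)) (han : a ≤ n) (hP : #P = n) :
    1 - 3 / 2 / (n : ℝ) ≤ (blockModel n a b P).real
      {G | SpectralPartitionSucceeds n (a + b) γ P G} := by
  have : Nonempty (Fin (2 * n)) := ⟨⟨0, by omega⟩⟩
  have hp := isBlockProb_edgeProb hb hab.le han P
  set μ := indepLaw (edgeProb n a b P)
  have hbad : μ.real {ω | ¬IsRegular (a + b) (edgeProb n a b P) ω} ≤ 3 / 2 / (n : ℝ) := by
    have h := measure_not_isRegular_le (by linarith) (hp.le hb hab.le)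
    rwa [Fintype.card_fin, Nat.cast_mul, Nat.cast_ofNat, ← div_div] at h
  have hsub : {ω | IsRegular (a + b) (edgeProb n a b P) ω} ⊆
      graphOf ⁻¹' {G | SpectralPartitionSucceeds n (a + b) γ P G} := fun ω hω =>
    ⟨exists_isSpectralPartitionOutput hn (isHermitian_adjacency _) _,
      fun _ _ hout => hω.isCorrect hn hp hb hab hγ hsep han hP hout⟩
  have hcompl : 1 - μ.real {ω | ¬IsRegular (a + b) (edgeProb n a b P) ω} =
      μ.real {ω | IsRegular (a + b) (edgeProb n a b P) ω} := by
    rw [← probReal_compl_eq_one_sub .of_discrete]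
    exact congr_arg μ.real (compl_compl _)
  calc 1 - 3 / 2 / (n : ℝ) ≤ μ.real {ω | IsRegular (a + b) (edgeProb n a b P) ω} := by linarith
    _ ≤ μ.real (graphOf ⁻¹' {G | SpectralPartitionSucceeds n (a + b) γ P G}) :=
      measureReal_mono hsub
    _ ≤ (blockModel n a b P).real {G | SpectralPartitionSucceeds n (a + b) γ P G} :=
      ENNReal.toReal_mono (measure_ne_top _ _)
        (Measure.le_map_apply (measurable_graphOf n).aemeasurable _)

end Algorithm

end SpectralSBM

end

theorem theorem2p1_general :
    ∃ C₁ : ℝ, 0 < C₁ ∧ ∀ a b γ : ℝ, 0 ≤ b → b < a → 0 < γ →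
      C₁ * (1 / γ ^ 2) ≤ (a - b) ^ 2 / (a + b) →
      ∀ V₁ : (n : ℕ) → Finset (Fin (2 * n)), (∀ n, (V₁ n).card = n) →
        Filter.Tendsto
          (fun n : ℕ => (SpectralSBM.blockModel n a b (V₁ n)).real
            {G | SpectralSBM.SpectralPartitionSucceeds n (a + b) γ (V₁ n) G})
          Filter.atTop (nhds 1) := by
  refine ⟨4 * 10 ^ 12, by norm_num, fun a b γ hb hab hγ hsep V₁ hV₁ => ?_⟩
  have hlim : Filter.Tendsto (fun n : ℕ => 1 - 3 / 2 / (n : ℝ)) Filter.atTop (nhds 1) := by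
    simpa using (tendsto_const_nhds (x := (1 : ℝ))).sub
      (tendsto_const_div_atTop_nhds_zero_nat (3 / 2 : ℝ))
  refine tendsto_of_tendsto_of_tendsto_of_le_of_le' hlim tendsto_const_nhds ?_
    (.of_forall fun _ => MeasureTheory.measureReal_le_one)
  filter_upwards [Filter.eventually_ge_atTop 1, Filter.eventually_ge_atTop ⌈a⌉₊] with n hn han
  exact SpectralSBM.le_measure_spectralPartitionSucceeds hn hb hab hγ hsep (Nat.ceil_le.1 han)
    (hV₁ n)

theorem theorem2p1 :
    ∃ C₀ C₁ : ℝ, 0 < C₀ ∧ 0 < C₁ ∧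
      ∀ a b γ : ℝ, C₀ < b → b < a → 0 < γ →
        C₁ * (1 / γ ^ 2) ≤ (a - b) ^ 2 / (a + b) →
        ∀ V₁ : (n : ℕ) → Finset (Fin (2 * n)), (∀ n, (V₁ n).card = n) →
          Filter.Tendsto
            (fun n : ℕ => (SpectralSBM.blockModel n a b (V₁ n)).real
              {G | SpectralSBM.SpectralPartitionSucceeds n (a + b) γ (V₁ n) G})
            Filter.atTop (nhds 1) := by
  obtain ⟨C₁, hC₁, h⟩ := theorem2p1_general
  exact ⟨1, C₁, one_pos, hC₁, fun a b γ hb => h a b γ (zero_le_one.trans hb.le)⟩
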